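/- Let $G=(V,E)$ be a finite simple graph, $k\ge 2$, and let each node $v$ have a bound $C_v\in\{1,k\}$; write $E(v)$ for the set of edges at $v$. A channel assignment $c$ of the edges is feasible if at most $C_v$ channels occur on $E(v)$ for each $v$, and at most $C_G=k$ channels occur altogether. Its number of conflicts is $\sum_{e=(u,v)\in E}(CF_e(u)+CF_e(v))$, where $CF_e(v)$ is the number of edges of $E(v)$ (including $e$) that have the same channel as $e$. Let $OPT$ be the minimum number of conflicts of a feasible assignment. Consider the vector program: minimize $$\sum_{v}\sum_{(e,e')\in E(v)^2}\tfrac1k\bigl((k-1)\,Y_e\cdot Y_{e'}+1\bigr)$$ over vectors $Y_e\in\mathbb R^m$ ($m$ arbitrary) with $|Y_e|=1$ for all $e$; $Y_e\cdot Y_{e'}=1$ if $e,e'\in E(v)$ and $C_v=1$; and $Y_e\cdot Y_{e'}\ge -\frac1{k-1}$ if $e,e'\in E(v)$. A $\delta$-solution is a feasible $(Y_e)$ whose value exceeds that of no feasible solution, in any dimension, by more than $\delta$; a $0$-solution is an optimal solution. (a) The vector program has an optimal solution in some dimension $m\le |E|$, and it is a relaxation: the value of every $\delta$-solution is at most $OPT+\delta$.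 (b) Let $k=2$ and let $(Y_e)$ be a $\delta$-solution in $\mathbb R^m$. Draw a standard Gaussian vector $r$ in $\mathbb R^m$ and give $e$ one channel if $r\cdot Y_e\ge 0$ and the other if $r\cdot Y_e<0$. The resulting assignment is always feasible, and its expected number of conflicts is at most $1.122\,(OPT+\delta)$; in particular at most $1.122\,OPT$ for an optimal solution. (c) There are functions $\epsilon,\eta:\mathbb N\to\mathbb R$ with $|\epsilon(k)|\sim\frac{\ln\ln k}{(\ln k)^{1/2}}$ and $\eta(k)=O\bigl(\frac{k}{(k-1)^2}\bigr)$ as $k\to\infty$ such that the following holds for all $k\ge2$, all $G$ and $C$ as above and every $\delta$-solution $(Y_e)$ in $\mathbb R^m$. Draw independent standard Gaussian vectors $g_1,\dots,g_k$ in $\mathbb R^m$ and give $e$ the channel $j$ for which $g_j\cdot Y_e$ is largest (the least such $j$ in case of ties). The resulting assignment is always feasible, and its expected number of conflicts is at most $$\Bigl(2-\frac1k-\frac{2(1+\epsilon(k))\ln k}{k}+\eta(k)\Bigr)(OPT+\delta).$$ -/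

import Mathlib

noncomputable section

namespace SoftColoring

variable {V : Type*} [Fintype V] [DecidableEq V]

/-- `E(v)`: the edges of `G` incident to `v`. -/
def inc (G : SimpleGraph V) [DecidableRel G.Adj] (v : V) : Finset G.edgeSet :=
  Finset.univ.filter fun e => v ∈ (e : Sym2 V)

/-- A channel assignment `c` is feasible if at most `CG` channels are used in the network and
at most `C v` channels are used on the edges incident to `v`, for every node `v`. -/
def IsFeasible (G : SimpleGraph V) [DecidableRel G.Adj] (C : V → ℕ) (CG : ℕ)
    (c : G.edgeSet → ℕ) : Prop :=
  (∀ v, ((inc G v).image c).card ≤ C v) ∧ (Finset.univ.image c).card ≤ CG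

/-- `CF_e(v)`: the number of edges at `v` (including `e`) with the same channel as `e`. -/
def confAt (G : SimpleGraph V) [DecidableRel G.Adj] (c : G.edgeSet → ℕ) (e : G.edgeSet) (v : V) :
    ℕ :=
  ((inc G v).filter fun e' => c e' = c e).card

/-- `CF_G = ∑_{e = (u, v)} (CF_e(u) + CF_e(v))`: the total number of conflicts. -/
def conflicts (G : SimpleGraph V) [DecidableRel G.Adj] (c : G.edgeSet → ℕ) : ℕ :=
  ∑ e : G.edgeSet, ∑ v ∈ Finset.univ.filter (fun v => v ∈ (e : Sym2 V)), confAt G c e v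

/-- `OPT`: the least number of conflicts of a feasible channel assignment. -/
def opt (G : SimpleGraph V) [DecidableRel G.Adj] (C : V → ℕ) (CG : ℕ) : ℕ :=
  sInf {n : ℕ | ∃ c : G.edgeSet → ℕ, IsFeasible G C CG c ∧ conflicts G c = n}

/-- Feasibility in the vector program, for vectors in `ℝ^m`. -/
structure VPFeasible (G : SimpleGraph V) [DecidableRel G.Adj] (C : V → ℕ) (k : ℕ) {m : ℕ}
    (Y : G.edgeSet → EuclideanSpace ℝ (Fin m)) : Prop where
  norm_eq : ∀ e, ‖Y e‖ = 1
  inner_eq : ∀ v, C v = 1 → ∀ e ∈ inc G v, ∀ e' ∈ inc G v, inner ℝ (Y e) (Y e') = 1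
  inner_ge : ∀ v, ∀ e ∈ inc G v, ∀ e' ∈ inc G v, -1 / ((k : ℝ) - 1) ≤ inner ℝ (Y e) (Y e')

/-- The objective of the vector program: the sum over all nodes `v` and all ordered pairs
(with repetition) of edges at `v`. -/
def vpValue (G : SimpleGraph V) [DecidableRel G.Adj] (k : ℕ) {m : ℕ}
    (Y : G.edgeSet → EuclideanSpace ℝ (Fin m)) : ℝ :=
  ∑ v, ∑ e ∈ inc G v, ∑ e' ∈ inc G v, 1 / (k : ℝ) * (((k : ℝ) - 1) * inner ℝ (Y e) (Y e') + 1)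

/-- `Y` solves the vector program up to the additive precision `δ`: it is feasible, and no feasible
solution, in whatever dimension, has a value smaller by more than `δ`. The case `δ = 0` is an
optimal solution. -/
def IsVPSolution (G : SimpleGraph V) [DecidableRel G.Adj] (C : V → ℕ) (k : ℕ) (δ : ℝ) {m : ℕ}
    (Y : G.edgeSet → EuclideanSpace ℝ (Fin m)) : Prop :=
  VPFeasible G C k Y ∧
    ∀ (m' : ℕ) (Y' : G.edgeSet → EuclideanSpace ℝ (Fin m')),
      VPFeasible G C k Y' → vpValue G k Y ≤ vpValue G k Y' + δ

/-- Goemans-Williamson rounding: the hyperplane through the origin with normal vector `r` splits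
the edges into two classes. For a standard Gaussian `r` the direction of `r` is uniform. -/
def gwRound {G : SimpleGraph V} {m : ℕ} (Y : G.edgeSet → EuclideanSpace ℝ (Fin m))
    (r : EuclideanSpace ℝ (Fin m)) : G.edgeSet → ℕ :=
  fun e => if 0 ≤ inner ℝ r (Y e) then 0 else 1

/-- Frieze-Jerrum rounding: the edge `e` gets the index `j` of the vector `g j` with the largest
inner product with `Y e` (the least such index in case of ties). -/
def fjRound {G : SimpleGraph V} {k m : ℕ} (Y : G.edgeSet → EuclideanSpace ℝ (Fin m))
    (g : Fin k → EuclideanSpace ℝ (Fin m)) : G.edgeSet → ℕ :=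
  fun e => sInf {j : ℕ | ∃ h : j < k, ∀ i : Fin k, inner ℝ (g i) (Y e) ≤ inner ℝ (g ⟨j, h⟩) (Y e)}

end SoftColoring

end

/-!
Write `ρ = ⟪Y e, Y e'⟫`. The number of conflicts is the sum over the nodes `v` and the ordered pairs
`(e, e')` of edges at `v` of the indicator of equal channels (`conflicts_eq`), and the value of the
vector program is the sum of `((k - 1) ρ + 1) / k` over the same pairs. Channels replaced by the
vertices of a regular simplex show that the program is a relaxation. Feasibility and value depend on
the Gram matrix only, so dimension `|E|` suffices, and compactness gives an optimal solution.

For both rounding schemes the probability of equal channels is bounded by an affine function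
`Γ / k + b ρ`. This is compared with the value not pair by pair but after summation over all pairs
at a node, where `∑ ρ = |∑ Y e|² ≥ 0`; hence `b` may be raised to `Γ (k - 1) / k`, and the expected
number of conflicts is at most `Γ` times the value (`sum_le_mul_vpValue`).

*Hyperplane rounding.* The separation probability is additive and monotone in the angle, so it is at
least `θ / π` (`div_pi_le_sepProb_cos`). With the inequality `0.439 (1 - cos θ) ≤ θ / π` the
probability of equal signs is at most `0.561 + 0.439 ρ`, so that `Γ = 2 * 0.561 = 1.122`.

*Argmax rounding.* Let `I ρ` (`sameProb`) be the probability that two Gaussian vectors in `ℝ^k` with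
correlated entries have their maximum at the same index, and let `μ` (`expMax`) be the expected
maximum of `k` standard Gaussian variables. As a function of two unit vectors, `I` is the Gram kernel
of the indicators of "the maximum is at `j`". Subtracting from these indicators their projections to
the constants and to the `j`-th Gaussian coordinate shows that `h ρ = I ρ - 1 / k - (μ² / k) ρ` is
positive definite on spheres of every dimension (`spherePosDef_sameProb`), and `h 0 = 0`. Instead of
a power series with nonnegative coefficients for `h`, only three consequences are used, each obtained
by testing positive definiteness on a few explicit vectors: `h` lies below its chord on `[0, 1]`
(`SpherePosDef.le_chord`), its odd part is nonnegative there, and its even part is at most `2 ρ²`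
(`SpherePosDef.even_le`). Therefore `I ρ ≤ 1 / k + (1 - 1 / k) ρ` for `ρ ≥ 0` and
`I (-s) ≤ 1 / k - (μ² / k) s + 2 s²` for `s ≥ 0`, which on `[-1 / (k - 1), 1]` gives an affine
majorant with `Γ = 2 - 1 / k - μ² / k + 2 / (k - 1)` (`sameProb_le`). Finally
`μ ≥ √(2 ln k) - 6` for large `k` (`sqrt_sub_le_expMax`), so `μ² ≥ 2 (1 + ε) ln k` eventually for
`ε = - ln ln k / √(ln k)`.
-/

noncomputable section

namespace SoftColoring

open MeasureTheory ProbabilityTheory Filter Asymptotics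
open scoped MatrixOrder

/-! ### Positive definite functions on spheres -/

/-- A function `h` is positive definite on spheres if, for unit vectors `v a` in any Euclidean
space, the matrix `h ⟪v a, v b⟫` is positive semidefinite. The vectors enter through their Gram
matrix, which is an arbitrary positive semidefinite matrix with unit diagonal. -/
def SpherePosDef (h : ℝ → ℝ) : Prop :=
  ∀ (ι : Type) [Fintype ι] [DecidableEq ι] (M : Matrix ι ι ℝ), M.PosSemidef → (∀ a, M a a = 1) →
    ∀ c : ι → ℝ, 0 ≤ ∑ a, ∑ b, c a * c b * h (M a b)

lemma posSemidef_of_quadratic {ι : Type*} [Fintype ι] {M : Matrix ι ι ℝ}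
    (hs : ∀ a b, M b a = M a b) (hq : ∀ x : ι → ℝ, 0 ≤ ∑ a, ∑ b, x a * x b * M a b) :
    M.PosSemidef := by
  refine Matrix.PosSemidef.of_dotProduct_mulVec_nonneg (Matrix.IsHermitian.ext ?_) fun x => ?_
  · intro a b; simpa using hs a b
  · refine (hq x).trans_eq ?_
    simp only [dotProduct, Matrix.mulVec, Finset.mul_sum, star_trivial]
    exact Finset.sum_congr rfl fun a _ => Finset.sum_congr rfl fun b _ => by ring

lemma quadratic_nonneg {ι : Type*} [Fintype ι] {M : Matrix ι ι ℝ} (hM : M.PosSemidef)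
    (x : ι → ℝ) : 0 ≤ ∑ a, ∑ b, x a * x b * M a b := by
  refine (hM.dotProduct_mulVec_nonneg x).trans_eq ?_
  simp only [dotProduct, Matrix.mulVec, Finset.mul_sum, star_trivial]
  exact Finset.sum_congr rfl fun a _ => Finset.sum_congr rfl fun b _ => by ring

/-- A function that is positive definite on spheres is positive definite on unit balls. Each vector
of norm at most `1` is completed to `N` unit vectors by pairwise orthogonal new components; averaging
over the `N` copies and letting `N → ∞` removes the contribution of the diagonal. -/
lemma SpherePosDef.ball {h : ℝ → ℝ} (hh : SpherePosDef h) {ι : Type} [Fintype ι] [DecidableEq ι]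
    {M : Matrix ι ι ℝ} (hM : M.PosSemidef) (hd : ∀ a, M a a ≤ 1) (c : ι → ℝ) :
    0 ≤ ∑ a, ∑ b, c a * c b * h (M a b) := by
  set D : ℝ := ∑ a, c a ^ 2 * (h 1 - h (M a a)) with hD
  have key : ∀ N : ℕ, 0 ≤ ∑ a, ∑ b, c a * c b * h (M a b) + D * (1 / ((N : ℝ) + 1)) := by
    intro N
    let M' : Matrix (ι × Fin (N + 1)) (ι × Fin (N + 1)) ℝ := fun p q =>
      M p.1 q.1 + if p = q then 1 - M p.1 p.1 else 0
    have hsym : ∀ a b, M b a = M a b := fun a b => by simpa using hM.1.apply a b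
    have h1 : M'.PosSemidef := by
      refine posSemidef_of_quadratic ?_ ?_
      · intro p q
        by_cases hpq : p = q
        · rw [hpq]
        · simp [M', hpq, Ne.symm hpq, hsym p.1 q.1]
      · intro x
        have e1 : ∑ p, ∑ q, x p * x q * M' p q =
            ∑ a, ∑ b, (∑ i, x (a, i)) * (∑ i, x (b, i)) * M a b
              + ∑ p, x p ^ 2 * (1 - M p.1 p.1) := by
          have : ∀ p, ∑ q, x p * x q * M' p q = ∑ q, x p * x q * M p.1 q.1
              + x p ^ 2 * (1 - M p.1 p.1) := by
            intro p
            simp only [M', mul_add, Finset.sum_add_distrib, mul_ite, mul_zero,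
              Finset.sum_ite_eq, Finset.mem_univ, if_true]
            ring
          simp only [this, Finset.sum_add_distrib]
          congr 1
          simp only [Fintype.sum_prod_type, Finset.sum_mul, Finset.mul_sum]
          refine Finset.sum_congr rfl fun a _ => ?_
          rw [Finset.sum_comm]
          exact Finset.sum_congr rfl fun b _ => Finset.sum_comm
        rw [e1]
        refine add_nonneg (quadratic_nonneg hM _) (Finset.sum_nonneg fun p _ => ?_)
        exact mul_nonneg (sq_nonneg _) (by linarith [hd p.1])
    have h2 := hh _ M' h1 (fun p => by simp [M']) (fun p => c p.1 / ((N : ℝ) + 1))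
    have hN : (0 : ℝ) < (N : ℝ) + 1 := by positivity
    have e2 : ∑ p, ∑ q, c p.1 / ((N : ℝ) + 1) * (c q.1 / ((N : ℝ) + 1)) * h (M' p q) =
        ∑ a, ∑ b, c a * c b * h (M a b) + D * (1 / ((N : ℝ) + 1)) := by
      have : ∀ p, ∑ q, c p.1 / ((N : ℝ) + 1) * (c q.1 / ((N : ℝ) + 1)) * h (M' p q) =
          ∑ q : ι × Fin (N + 1), c p.1 / ((N : ℝ) + 1) * (c q.1 / ((N : ℝ) + 1)) * h (M p.1 q.1)
          + c p.1 ^ 2 / ((N : ℝ) + 1) ^ 2 * (h 1 - h (M p.1 p.1)) := by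
        intro p
        have : ∀ q, c p.1 / ((N : ℝ) + 1) * (c q.1 / ((N : ℝ) + 1)) * h (M' p q) =
            c p.1 / ((N : ℝ) + 1) * (c q.1 / ((N : ℝ) + 1)) * h (M p.1 q.1) +
            if p = q then c p.1 ^ 2 / ((N : ℝ) + 1) ^ 2 * (h 1 - h (M p.1 p.1)) else 0 := by
          intro q
          by_cases hpq : p = q
          · subst hpq; simp [M']; field_simp; ring
          · simp [M', hpq]
        simp only [this, Finset.sum_add_distrib, Finset.sum_ite_eq, Finset.mem_univ, if_true]
      simp only [this, Finset.sum_add_distrib]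
      congr 1
      · simp only [Fintype.sum_prod_type, Finset.sum_const, Finset.card_univ, Fintype.card_fin,
          nsmul_eq_mul, Finset.mul_sum]
        refine Finset.sum_congr rfl fun a _ => Finset.sum_congr rfl fun b _ => ?_
        push_cast
        field_simp
      · simp only [Fintype.sum_prod_type, Finset.sum_const, Finset.card_univ, Fintype.card_fin,
          nsmul_eq_mul, hD, Finset.sum_mul]
        refine Finset.sum_congr rfl fun a _ => ?_
        push_cast
        field_simp
    rw [e2] at h2
    exact h2
  have lim : Filter.Tendsto (fun N : ℕ => ∑ a, ∑ b, c a * c b * h (M a b)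
      + D * (1 / ((N : ℝ) + 1))) Filter.atTop
      (nhds (∑ a, ∑ b, c a * c b * h (M a b) + D * 0)) :=
    (tendsto_one_div_add_atTop_nhds_zero_nat.const_mul D).const_add _
  simpa using ge_of_tendsto' lim key

/-- `h r = h ⟪v, v⟫` for a vector with `|v|² = r`. -/
lemma SpherePosDef.nonneg {h : ℝ → ℝ} (hh : SpherePosDef h) {r : ℝ} (h0 : 0 ≤ r) (h1 : r ≤ 1) :
    0 ≤ h r := by
  have := hh.ball (ι := Unit) (M := fun _ _ => r)
    (posSemidef_of_quadratic (fun _ _ => rfl) fun x => by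
      simp only [Finset.univ_unique, Finset.sum_singleton]
      exact mul_nonneg (mul_self_nonneg _) h0) (fun _ => h1) (fun _ => 1)
  simpa using this

lemma SpherePosDef.abs_le {h : ℝ → ℝ} (hh : SpherePosDef h) {r : ℝ} (h0 : -1 ≤ r) (h1 : r ≤ 1) :
    |h r| ≤ h 1 := by
  have key : ∀ s : ℝ, s ^ 2 = 1 → 0 ≤ h 1 + s * h r := by
    intro s hs
    have := hh (Fin 2) (fun a b => if a = b then 1 else r)
      (posSemidef_of_quadratic (fun a b => by simp [eq_comm]) fun x => by
        simp [Fin.sum_univ_two]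
        nlinarith [mul_nonneg (sub_nonneg.2 h1) (sq_nonneg (x 0 - x 1)),
          mul_nonneg (neg_le_iff_add_nonneg.1 h0) (sq_nonneg (x 0 + x 1))])
      (fun _ => by simp) ![1, s]
    simp only [Fin.sum_univ_two, Matrix.cons_val_zero, Matrix.cons_val_one, if_true, one_ne_zero,
      zero_ne_one, if_false] at this
    linear_combination this / 2 + h 1 / 2 * hs
  rw [_root_.abs_le]
  constructor
  · linarith [key 1 (by norm_num)]
  · linarith [key (-1) (by norm_num)]

/-- Midpoint convexity on `[0, 1]`, from the four vectors `p ± q`, `p ± q'` with `p, q, q'`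
orthogonal, `|p|² = (a + b) / 2` and `|q|² = |q'|² = (b - a) / 2`, with signs `+, +, -, -`. -/
lemma SpherePosDef.midpoint {h : ℝ → ℝ} (hh : SpherePosDef h) {a b : ℝ} (ha : 0 ≤ a) (hab : a ≤ b)
    (hb : b ≤ 1) : h ((a + b) / 2) ≤ (h a + h b) / 2 := by
  have := hh.ball (ι := Fin 2 × Fin 2)
    (M := fun p q => if p.1 = q.1 then (if p.2 = q.2 then b else a) else (a + b) / 2)
    (posSemidef_of_quadratic (fun p q => by simp [eq_comm]) fun x => by
      simp [Fintype.sum_prod_type, Fin.sum_univ_two]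
      nlinarith [mul_nonneg (add_nonneg ha (ha.trans hab))
          (sq_nonneg (x (0, 0) + x (0, 1) + x (1, 0) + x (1, 1))),
        mul_nonneg (sub_nonneg.2 hab) (sq_nonneg (x (0, 0) - x (0, 1))),
        mul_nonneg (sub_nonneg.2 hab) (sq_nonneg (x (1, 0) - x (1, 1)))])
    (fun p => by simpa using hb) (fun p => if p.1 = 0 then 1 else -1)
  simp [Fintype.sum_prod_type, Fin.sum_univ_two] at this
  linarith

lemma le_zero_of_le_div_two_pow {x C : ℝ} (h : ∀ n : ℕ, x ≤ C / 2 ^ n) : x ≤ 0 := by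
  have lim : Filter.Tendsto (fun n : ℕ => C * (1 / 2 : ℝ) ^ n) Filter.atTop (nhds (C * 0)) :=
    (tendsto_pow_atTop_nhds_zero_of_lt_one (by norm_num) (by norm_num)).const_mul C
  rw [mul_zero] at lim
  refine ge_of_tendsto' lim fun n => (h n).trans_eq ?_
  rw [one_div, inv_pow, div_eq_mul_inv]

/-- The chord bound on `[0, 1]`. The excess over the chord is bounded, and midpoint convexity with
one of the end points halves any upper bound of it. -/
lemma SpherePosDef.le_chord {h : ℝ → ℝ} (hh : SpherePosDef h) {r : ℝ} (h0 : 0 ≤ r) (h1 : r ≤ 1) :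
    h r ≤ (1 - r) * h 0 + r * h 1 := by
  have key : ∀ n : ℕ, ∀ r : ℝ, 0 ≤ r → r ≤ 1 →
      h r - ((1 - r) * h 0 + r * h 1) ≤ h 1 / 2 ^ n := by
    intro n
    induction n with
    | zero =>
      intro r h0 h1
      have e1 := (le_abs_self _).trans (hh.abs_le (r := r) (by linarith) h1)
      have e2 := mul_nonneg (sub_nonneg.2 h1) (hh.nonneg le_rfl zero_le_one)
      have e3 := mul_nonneg h0 (hh.nonneg zero_le_one le_rfl)
      simp only [pow_zero, div_one]
      linarith
    | succ n ih =>
      intro r h0 h1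
      have e : h 1 / 2 ^ (n + 1) = (h 1 / 2 ^ n) / 2 := by rw [pow_succ]; field_simp
      rw [e]
      rcases le_total r (1 / 2) with hr | hr
      · have i1 := ih (2 * r) (by linarith) (by linarith)
        have i2 := hh.midpoint (a := 0) (b := 2 * r) le_rfl (by linarith) (by linarith)
        rw [show (0 + 2 * r) / 2 = r by ring] at i2
        linarith
      · have i1 := ih (2 * r - 1) (by linarith) (by linarith)
        have i2 := hh.midpoint (a := 2 * r - 1) (b := 1) (by linarith) (by linarith) le_rfl
        rw [show (2 * r - 1 + 1) / 2 = r by ring] at i2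
        linarith
  linarith [le_zero_of_le_div_two_pow fun n => key n r h0 h1]

/-- An even positive definite function that vanishes at `0` loses a factor `2` from `r` to `r / √2`:
compare an orthogonal pair of norm `√r` with its rotation by `π / 4`. -/
lemma SpherePosDef.even_div_sqrt_two {h : ℝ → ℝ} (hh : SpherePosDef h) (he : ∀ x, h (-x) = h x)
    (hz : h 0 = 0) {r : ℝ} (h0 : 0 ≤ r) (h1 : r ≤ 1) : h (r / √2) ≤ h r / 2 := by
  have := hh.ball (ι := Fin 2 × Fin 2)
    (M := fun p q => if p.1 = q.1 then (if p.2 = q.2 then r else 0) else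
      if p.2 = 1 ∧ q.2 = 1 then -(r / √2) else r / √2)
    (posSemidef_of_quadratic (fun p q => by simp [eq_comm, and_comm]) fun x => by
      simp [Fintype.sum_prod_type, Fin.sum_univ_two]
      have e : ∀ a b c d : ℝ, 0 ≤ r * ((a + (c + d) / √2) ^ 2 + (b + (c - d) / √2) ^ 2) :=
        fun a b c d => by positivity
      refine (e (x (0, 0)) (x (0, 1)) (x (1, 0)) (x (1, 1))).trans_eq ?_
      field_simp
      ring_nf
      simp only [Real.sq_sqrt (show (0 : ℝ) ≤ 2 by norm_num)]
      ring)
    (fun p => by simpa using h1) (fun p => if p.1 = 0 then 1 else -1)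
  simp [Fintype.sum_prod_type, Fin.sum_univ_two, he, hz] at this
  linarith

/-- Iterating the halving step from `r` up to the interval `[1 / √2, 1]`. -/
lemma SpherePosDef.even_le {h : ℝ → ℝ} (hh : SpherePosDef h) (he : ∀ x, h (-x) = h x)
    (hz : h 0 = 0) {r : ℝ} (h0 : 0 ≤ r) (h1 : r ≤ 1) : h r ≤ 2 * r ^ 2 * h 1 := by
  have s2 : √2 * √2 = 2 := Real.mul_self_sqrt (by norm_num)
  have s2p : 0 < √2 := by positivity
  have hp : 0 ≤ h 1 := hh.nonneg zero_le_one le_rfl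
  have hle : ∀ r : ℝ, 0 ≤ r → r ≤ 1 → h r ≤ h 1 := fun r h0 h1 =>
    (le_abs_self _).trans (hh.abs_le (by linarith) h1)
  have key : ∀ n : ℕ, ∀ r : ℝ, 0 ≤ r → r ≤ 1 → h r - 2 * r ^ 2 * h 1 ≤ h 1 / 2 ^ n := by
    intro n
    induction n with
    | zero =>
      intro r h0 h1
      have := mul_nonneg (sq_nonneg r) hp
      simp only [pow_zero, div_one]
      linarith [hle r h0 h1]
    | succ n ih =>
      intro r h0 h1
      have e : h 1 / 2 ^ (n + 1) = (h 1 / 2 ^ n) / 2 := by rw [pow_succ]; field_simp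
      have ep : 0 ≤ h 1 / 2 ^ n := by positivity
      rw [e]
      rcases le_total (r * √2) 1 with hr | hr
      · have i1 := ih (r * √2) (by positivity) hr
        have i2 := hh.even_div_sqrt_two he hz (r := r * √2) (by positivity) hr
        rw [mul_div_assoc, div_self s2p.ne', mul_one] at i2
        rw [show (r * √2) ^ 2 = 2 * r ^ 2 by rw [mul_pow, Real.sq_sqrt (by norm_num)]; ring] at i1
        linarith
      · have : 1 ≤ 2 * r ^ 2 := by
          have := mul_self_le_mul_self zero_le_one hr
          nlinarith
        nlinarith [hle r h0 h1]
  linarith [le_zero_of_le_div_two_pow fun n => key n r h0 h1]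

/-- The even and the odd part (`s = 1`, `s = -1`) of a positive definite function are positive
definite: pass to the vectors `± v a`. -/
lemma SpherePosDef.parity {h : ℝ → ℝ} (hh : SpherePosDef h) {s : ℝ} (hs : s ^ 2 = 1) :
    SpherePosDef fun x => (h x + s * h (-x)) / 2 := by
  intro ι _ _ M hM hd c
  have hsym : ∀ a b, M b a = M a b := fun a b => by simpa using hM.1.apply a b
  have := hh (ι × Fin 2) (fun p q => (if p.2 = q.2 then 1 else -1) * M p.1 q.1)
    (posSemidef_of_quadratic (fun p q => by simp [eq_comm, hsym p.1 q.1]) fun x => by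
      refine (quadratic_nonneg hM fun a => x (a, 0) - x (a, 1)).trans_eq ?_
      simp only [Fintype.sum_prod_type, Fin.sum_univ_two, ← Finset.sum_add_distrib]
      refine Finset.sum_congr rfl fun a _ => Finset.sum_congr rfl fun b _ => ?_
      simp
      ring)
    (fun p => by simp [hd]) (fun p => if p.2 = 0 then c p.1 / 2 else s * c p.1 / 2)
  refine this.trans_eq ?_
  simp only [Fintype.sum_prod_type, Fin.sum_univ_two, ← Finset.sum_add_distrib]
  refine Finset.sum_congr rfl fun a _ => Finset.sum_congr rfl fun b _ => ?_
  simp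
  linear_combination (c a * c b * h (M a b) / 4) * hs

/-- For negative arguments the odd part has a favourable sign and the even part is of second
order. -/
lemma SpherePosDef.neg_le {h : ℝ → ℝ} (hh : SpherePosDef h) (hz : h 0 = 0) {s : ℝ} (h0 : 0 ≤ s)
    (h1 : s ≤ 1) : h (-s) ≤ 2 * s ^ 2 * h 1 := by
  have e := (hh.parity (s := 1) (by norm_num)).even_le (fun x => by ring_nf) (by simp [hz]) h0 h1
  have o := (hh.parity (s := -1) (by norm_num)).nonneg h0 h1
  have a := (le_abs_self _).trans (hh.abs_le (r := -1) le_rfl (by norm_num))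
  have : (h 1 + 1 * h (-1)) / 2 ≤ h 1 := by linarith
  have := mul_le_mul_of_nonneg_left this (show 0 ≤ 2 * s ^ 2 by positivity)
  linarith

/-! ### Gaussian pairs with a given correlation -/

lemma exists_gram_eq {ι : Type*} [Fintype ι] [DecidableEq ι] {M : Matrix ι ι ℝ}
    (hM : M.PosSemidef) :
    ∃ v : ι → EuclideanSpace ℝ ι, ∀ a b, inner ℝ (v a) (v b) = M a b := by
  have h1 : CFC.sqrt M * CFC.sqrt M = M := CFC.sqrt_mul_sqrt_self _ hM.nonneg
  have h2 : IsSelfAdjoint (CFC.sqrt M) := (CFC.sqrt_nonneg M).isSelfAdjoint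
  have h3 : ∀ a b, CFC.sqrt M b a = CFC.sqrt M a b := fun a b => by
    conv_lhs => rw [← h2.star_eq]
    simp [Matrix.star_apply]
  refine ⟨fun a => WithLp.toLp 2 fun i => CFC.sqrt M i a, fun a b => ?_⟩
  conv_rhs => rw [← h1, Matrix.mul_apply]
  simp only [PiLp.inner_apply, RCLike.inner_apply, conj_trivial]
  exact Finset.sum_congr rfl fun i _ => by rw [h3 a i, mul_comm]

/-- A family of `n` vectors in a Euclidean space can be moved into dimension `n` without changing
its inner products. -/
lemma exists_inner_eq {ι F : Type*} [Fintype ι] [NormedAddCommGroup F] [InnerProductSpace ℝ F]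
    (Y : ι → F) : ∃ v : ι → EuclideanSpace ℝ (Fin (Fintype.card ι)),
      ∀ a b, inner ℝ (v a) (v b) = inner ℝ (Y a) (Y b) := by
  classical
  obtain ⟨v, hv⟩ := exists_gram_eq (Matrix.posSemidef_gram ℝ Y)
  let e := LinearIsometryEquiv.piLpCongrLeft 2 ℝ ℝ (Fintype.equivFin ι)
  exact ⟨fun a => e (v a), fun a b => by rw [e.inner_map_map, hv, Matrix.gram_apply]⟩

/-- The law of a pair of standard Gaussian variables with correlation `ρ`. -/
def corrGaussian (ρ : ℝ) : Measure (ℝ × ℝ) :=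
  ((gaussianReal 0 1).prod (gaussianReal 0 1)).map fun p => (p.1, ρ * p.1 + √(1 - ρ ^ 2) * p.2)

instance (ρ : ℝ) : IsProbabilityMeasure (corrGaussian ρ) :=
  Measure.isProbabilityMeasure_map (by fun_prop)

section law

variable {E : Type*} [NormedAddCommGroup E] [InnerProductSpace ℝ E] [FiniteDimensional ℝ E]
  [MeasurableSpace E] [BorelSpace E]

lemma continuousLinearMap_prod_apply (L : StrongDual ℝ (ℝ × ℝ)) (x y : ℝ) :
    L (x, y) = x * L (1, 0) + y * L (0, 1) := by
  have : ((x, y) : ℝ × ℝ) = x • (1, 0) + y • (0, 1) := by simp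
  rw [this, map_add, map_smul, map_smul, smul_eq_mul, smul_eq_mul]

lemma charFunDual_gaussianReal (L : StrongDual ℝ ℝ) :
    charFunDual (gaussianReal 0 1) L = Complex.exp (-((L 1 ^ 2 : ℝ) : ℂ) / 2) := by
  rw [IsGaussian.charFunDual_eq]
  have h1 : ∫ x, L x ∂(gaussianReal 0 1) = 0 := by
    rw [integral_continuousLinearMap_gaussianReal]; simp
  have h2 : Var[L; gaussianReal 0 1] = L 1 ^ 2 := by
    have : (L : ℝ → ℝ) = fun x => L 1 * x := by
      ext x
      have := L.map_smul x 1
      rwa [smul_eq_mul, mul_one, smul_eq_mul, mul_comm] at this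
    rw [this, variance_const_mul, variance_fun_id_gaussianReal]; simp
  rw [h2]
  have h1' : (∫ x, ((L x : ℝ) : ℂ) ∂(gaussianReal 0 1)) = 0 := by
    rw [integral_complex_ofReal, h1]; simp
  simp [h1', neg_div]

/-- Projecting a standard Gaussian vector to two unit vectors gives a standard Gaussian pair whose
correlation is the inner product of the vectors. -/
lemma map_inner_inner_stdGaussian {u v : E} (hu : ‖u‖ = 1) (hv : ‖v‖ = 1) :
    (stdGaussian E).map (fun r => (inner ℝ r u, inner ℝ r v)) = corrGaussian (inner ℝ u v) := by
  set ρ : ℝ := inner ℝ u v with hρ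
  have hρ1 : 0 ≤ 1 - ρ ^ 2 := by
    have := abs_real_inner_le_norm u v
    rw [hu, hv, one_mul] at this
    nlinarith [abs_le.1 this]
  have : IsProbabilityMeasure ((stdGaussian E).map fun r => (inner ℝ r u, inner ℝ r v)) :=
    Measure.isProbabilityMeasure_map (by fun_prop)
  refine Measure.ext_of_charFunDual (funext fun L => ?_)
  let T : E →L[ℝ] ℝ × ℝ := (innerSL ℝ u).prod (innerSL ℝ v)
  let S : ℝ × ℝ →L[ℝ] ℝ × ℝ := (ContinuousLinearMap.fst ℝ ℝ ℝ).prod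
    (ρ • ContinuousLinearMap.fst ℝ ℝ ℝ + √(1 - ρ ^ 2) • ContinuousLinearMap.snd ℝ ℝ ℝ)
  have hT : (fun r : E => (inner ℝ r u, inner ℝ r v)) = T := by
    ext r <;> simp [T, real_inner_comm]
  have hS : (fun p : ℝ × ℝ => (p.1, ρ * p.1 + √(1 - ρ ^ 2) * p.2)) = S := by
    ext p <;> simp [S]
  rw [corrGaussian, hT, hS, charFunDual_map, charFunDual_map, charFunDual_stdGaussian,
    charFunDual_prod, charFunDual_gaussianReal, charFunDual_gaussianReal, ← Complex.exp_add]
  congr 1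
  set a := L (1, 0)
  set b := L (0, 1)
  have e1 : L.comp T = innerSL ℝ (a • u + b • v) := by
    ext r
    simp only [ContinuousLinearMap.comp_apply, T, ContinuousLinearMap.prod_apply]
    rw [continuousLinearMap_prod_apply]
    simp [mul_comm, a, b]
  have e2 : ‖L.comp T‖ ^ 2 = a ^ 2 + 2 * a * b * ρ + b ^ 2 := by
    rw [e1, innerSL_apply_norm, ← real_inner_self_eq_norm_sq]
    simp only [inner_add_left, inner_add_right, inner_smul_left, inner_smul_right,
      real_inner_self_eq_norm_sq, hu, hv, real_inner_comm u v, conj_trivial, ← hρ]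
    ring
  have e3 : ((L.comp S).comp (.inl ℝ ℝ ℝ)) 1 = a + ρ * b := by
    simp only [ContinuousLinearMap.comp_apply, ContinuousLinearMap.inl_apply, S]
    simp [a, b]
    rw [continuousLinearMap_prod_apply]; simp
  have e4 : ((L.comp S).comp (.inr ℝ ℝ ℝ)) 1 = √(1 - ρ ^ 2) * b := by
    simp only [ContinuousLinearMap.comp_apply, ContinuousLinearMap.inr_apply, S]
    simp [b]
    rw [continuousLinearMap_prod_apply]; simp
  have e5 : ‖L.comp T‖ ^ 2 = (a + ρ * b) ^ 2 + (√(1 - ρ ^ 2) * b) ^ 2 := by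
    rw [e2, mul_pow, Real.sq_sqrt hρ1]; ring
  rw [e3, e4]
  have : ((‖L.comp T‖ : ℝ) : ℂ) ^ 2 =
      (((a + ρ * b) ^ 2 : ℝ) : ℂ) + (((√(1 - ρ ^ 2) * b) ^ 2 : ℝ) : ℂ) := by
    exact_mod_cast e5
  rw [this]
  ring

end law

/-- For every `ρ ∈ [-1, 1]` there are unit vectors in the plane with inner product `ρ`. -/
lemma exists_inner_eq_of_abs_le {ρ : ℝ} (h0 : -1 ≤ ρ) (h1 : ρ ≤ 1) :
    ∃ u v : EuclideanSpace ℝ (Fin 2), ‖u‖ = 1 ∧ ‖v‖ = 1 ∧ inner ℝ u v = ρ := by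
  have hρ1 : 0 ≤ 1 - ρ ^ 2 := by nlinarith
  refine ⟨!₂[1, 0], !₂[ρ, √(1 - ρ ^ 2)], ?_, ?_, ?_⟩
  · simp [EuclideanSpace.norm_eq, Fin.sum_univ_two]
  · simp [EuclideanSpace.norm_eq, Fin.sum_univ_two, Real.sq_sqrt hρ1]
  · simp [PiLp.inner_apply, Fin.sum_univ_two]

lemma corrGaussian_map_swap {ρ : ℝ} (h0 : -1 ≤ ρ) (h1 : ρ ≤ 1) :
    (corrGaussian ρ).map (fun p => (p.2, p.1)) = corrGaussian ρ := by
  obtain ⟨u, v, hu, hv, h⟩ := exists_inner_eq_of_abs_le h0 h1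
  rw [← h]
  conv_lhs => rw [← map_inner_inner_stdGaussian hu hv, Measure.map_map (by fun_prop) (by fun_prop)]
  conv_rhs => rw [real_inner_comm, ← map_inner_inner_stdGaussian hv hu]
  rfl

/-! ### The argmax of a Gaussian vector -/

/-- The least index of a largest entry of `x`. -/
def argmax {k : ℕ} (x : Fin k → ℝ) : ℕ :=
  sInf {j : ℕ | ∃ h : j < k, ∀ i, x i ≤ x ⟨j, h⟩}

/-- The indicator of the event that the maximum of `x` is at `j`. -/
def maxInd {k : ℕ} (x : Fin k → ℝ) (j : Fin k) : ℝ := if argmax x = j then 1 else 0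

lemma abs_maxInd_le {k : ℕ} (x : Fin k → ℝ) (j : Fin k) : |maxInd x j| ≤ 1 := by
  unfold maxInd; split_ifs <;> simp

section argmax

variable {k : ℕ} [NeZero k]

lemma argmax_spec (x : Fin k → ℝ) : ∃ h : argmax x < k, ∀ i, x i ≤ x ⟨argmax x, h⟩ := by
  obtain ⟨j, hj⟩ := Finite.exists_max x
  exact Nat.sInf_mem (s := {j : ℕ | ∃ h : j < k, ∀ i, x i ≤ x ⟨j, h⟩}) ⟨j, j.2, hj⟩

lemma measurable_argmax : Measurable (argmax : (Fin k → ℝ) → ℕ) := by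
  set A : ℕ → Set (Fin k → ℝ) := fun j => {x | ∃ h : j < k, ∀ i, x i ≤ x ⟨j, h⟩} with hA
  have hm : ∀ j, MeasurableSet (A j) := by
    intro j
    by_cases h : j < k
    · simp only [hA, h, exists_true_left, Set.ofPred_forall]
      exact MeasurableSet.iInter fun i =>
        measurableSet_le (measurable_pi_apply i) (measurable_pi_apply _)
    · simp [hA, h]
  refine measurable_to_countable' fun j => ?_
  have : argmax ⁻¹' {j} = A j ∩ ⋂ m ∈ Finset.range j, (A m)ᶜ := by
    ext x
    simp only [Set.mem_preimage, Set.mem_singleton_iff, Set.mem_inter_iff, Set.mem_iInter,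
      Finset.mem_range, Set.mem_compl_iff]
    constructor
    · rintro rfl
      exact ⟨argmax_spec x, fun m hm h => absurd (Nat.sInf_le h) (not_le.2 hm)⟩
    · rintro ⟨h1, h2⟩
      refine le_antisymm (Nat.sInf_le h1) (not_lt.1 fun h => h2 _ h (argmax_spec x))
  rw [this]
  exact (hm j).inter (Finset.measurableSet_biInter _ fun m _ => (hm m).compl)

lemma maxInd_eq (x : Fin k → ℝ) (j : Fin k) :
    maxInd x j = if j = ⟨argmax x, (argmax_spec x).1⟩ then 1 else 0 := by
  simp only [maxInd, Fin.ext_iff, eq_comm]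

lemma sum_maxInd_mul (x y : Fin k → ℝ) :
    ∑ j, maxInd x j * y j = y ⟨argmax x, (argmax_spec x).1⟩ := by
  simp [maxInd_eq]

lemma sum_maxInd (x : Fin k → ℝ) : ∑ j, maxInd x j = 1 := by
  simp [maxInd_eq]

lemma sum_maxInd_mul_maxInd (x y : Fin k → ℝ) :
    ∑ j, maxInd x j * maxInd y j = if argmax x = argmax y then 1 else 0 := by
  rw [sum_maxInd_mul, maxInd]
  simp [eq_comm]

lemma measurable_maxInd (j : Fin k) : Measurable fun x : Fin k → ℝ => maxInd x j :=
  Measurable.ite (measurable_argmax (measurableSet_singleton _)) measurable_const measurable_const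

end argmax

/-- The law of `k` independent standard Gaussian variables. -/
abbrev stdPi (k : ℕ) : Measure (Fin k → ℝ) := Measure.pi fun _ => gaussianReal 0 1

/-- The law of `k` independent standard Gaussian pairs with correlation `ρ`. -/
abbrev corrPi (k : ℕ) (ρ : ℝ) : Measure (Fin k → ℝ × ℝ) := Measure.pi fun _ => corrGaussian ρ

lemma corrPi_eq_map (k : ℕ) (ρ : ℝ) : corrPi k ρ = ((stdPi k).prod (stdPi k)).map
    fun q j => (q.1 j, ρ * q.1 j + √(1 - ρ ^ 2) * q.2 j) := by
  have h1 : corrPi k ρ = (Measure.pi fun _ : Fin k =>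
      (gaussianReal 0 1).prod (gaussianReal 0 1)).map
        fun w j => ((w j).1, ρ * (w j).1 + √(1 - ρ ^ 2) * (w j).2) := by
    have : ∀ _ : Fin k, SigmaFinite (((gaussianReal 0 1).prod (gaussianReal 0 1)).map
        fun p : ℝ × ℝ => (p.1, ρ * p.1 + √(1 - ρ ^ 2) * p.2)) := fun _ =>
      inferInstanceAs (SigmaFinite (corrGaussian ρ))
    exact (Measure.pi_map_pi (fun _ => by fun_prop)).symm
  have h2 := measurePreserving_arrowProdEquivProdArrow ℝ ℝ (Fin k)
    (fun _ => gaussianReal 0 1) (fun _ => gaussianReal 0 1)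
  rw [h1, ← h2.map_eq, Measure.map_map (by fun_prop) (MeasurableEquiv.measurable _)]
  rfl

lemma map_inner_inner_pi {E : Type*} [NormedAddCommGroup E] [InnerProductSpace ℝ E]
    [FiniteDimensional ℝ E] [MeasurableSpace E] [BorelSpace E] (k : ℕ) {u v : E} (hu : ‖u‖ = 1)
    (hv : ‖v‖ = 1) :
    (Measure.pi fun _ : Fin k => stdGaussian E).map
      (fun g j => (inner ℝ (g j) u, inner ℝ (g j) v)) = corrPi k (inner ℝ u v) := by
  have : ∀ _ : Fin k, SigmaFinite ((stdGaussian E).map fun r => (inner ℝ r u, inner ℝ r v)) := by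
    intro _; rw [map_inner_inner_stdGaussian hu hv]; infer_instance
  refine (Measure.pi_map_pi (f := fun _ r => (inner ℝ r u, inner ℝ r v))
    (fun _ => by fun_prop)).trans ?_
  rw [map_inner_inner_stdGaussian hu hv]

lemma measurePreserving_swap_corrPi (k : ℕ) {ρ : ℝ} (h0 : -1 ≤ ρ) (h1 : ρ ≤ 1) :
    MeasurePreserving (fun (p : Fin k → ℝ × ℝ) j => ((p j).2, (p j).1)) (corrPi k ρ) (corrPi k ρ) := by
  refine ⟨by fun_prop, ?_⟩
  have : ∀ _ : Fin k, SigmaFinite ((corrGaussian ρ).map fun p => (p.2, p.1)) := by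
    intro _; rw [corrGaussian_map_swap h0 h1]; infer_instance
  refine (Measure.pi_map_pi (f := fun _ (p : ℝ × ℝ) => (p.2, p.1)) (fun _ => by fun_prop)).trans ?_
  rw [corrGaussian_map_swap h0 h1]

/-! ### Moments of Gaussian vectors -/

lemma memLp_eval_stdPi {k : ℕ} (j : Fin k) : MemLp (fun x => x j) 2 (stdPi k) :=
  (memLp_id_gaussianReal' 2 (by simp)).comp_measurePreserving (measurePreserving_eval _ j)

lemma integral_eval_stdPi {k : ℕ} (j : Fin k) : ∫ x, x j ∂(stdPi k) = 0 := by
  rw [integral_eval]; exact integral_id_gaussianReal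

lemma integral_sq_gaussianReal : ∫ x, x * x ∂(gaussianReal 0 1) = 1 := by
  have h := variance_fun_id_gaussianReal (μ := 0) (v := 1)
  rw [variance_of_integral_eq_zero (by fun_prop) integral_id_gaussianReal] at h
  simpa [sq] using h

lemma integral_sq_eval_stdPi {k : ℕ} (j : Fin k) : ∫ x, x j * x j ∂(stdPi k) = 1 := by
  rw [← integral_sq_gaussianReal,
    ← (measurePreserving_eval (fun _ : Fin k => gaussianReal 0 1) j).map_eq,
    integral_map (measurable_pi_apply j).aemeasurable (by fun_prop)]

section corr

variable {k : ℕ} {ρ : ℝ}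

lemma memLp_fst_corrPi (j : Fin k) : MemLp (fun p => (p j).1) 2 (corrPi k ρ) := by
  rw [corrPi_eq_map, memLp_map_measure_iff (by fun_prop : Measurable _).aestronglyMeasurable (by fun_prop)]
  exact (memLp_eval_stdPi j).comp_fst _

lemma memLp_snd_corrPi (j : Fin k) : MemLp (fun p => (p j).2) 2 (corrPi k ρ) := by
  rw [corrPi_eq_map, memLp_map_measure_iff (by fun_prop : Measurable _).aestronglyMeasurable (by fun_prop)]
  exact (((memLp_eval_stdPi j).comp_fst _).const_mul ρ).add
    (((memLp_eval_stdPi j).comp_snd _).const_mul _)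

lemma integral_fst_corrPi (j : Fin k) : ∫ p, (p j).1 ∂(corrPi k ρ) = 0 := by
  rw [corrPi_eq_map, integral_map (by fun_prop) (by fun_prop : Measurable _).aestronglyMeasurable]
  simp only
  rw [integral_fun_fst (fun x : Fin k → ℝ => x j), integral_eval_stdPi]
  simp

lemma integral_snd_corrPi (h0 : -1 ≤ ρ) (h1 : ρ ≤ 1) (j : Fin k) :
    ∫ p, (p j).2 ∂(corrPi k ρ) = 0 := by
  rw [← integral_fst_corrPi (ρ := ρ) j]
  conv_rhs => rw [← (measurePreserving_swap_corrPi k h0 h1).map_eq]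
  rw [integral_map (by fun_prop) (by fun_prop : Measurable _).aestronglyMeasurable]

lemma integral_mul_corrPi (j : Fin k) : ∫ p, (p j).1 * (p j).2 ∂(corrPi k ρ) = ρ := by
  have hL := memLp_eval_stdPi j
  rw [corrPi_eq_map, integral_map (by fun_prop) (by fun_prop)]
  have : ∀ q : (Fin k → ℝ) × (Fin k → ℝ), q.1 j * (ρ * q.1 j + √(1 - ρ ^ 2) * q.2 j) =
      ρ * (q.1 j * q.1 j) + √(1 - ρ ^ 2) * (q.1 j * q.2 j) := fun q => by ring
  simp only [this]
  rw [integral_add, integral_const_mul, integral_const_mul,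
    integral_prod_mul (fun x : Fin k → ℝ => x j) (fun x : Fin k → ℝ => x j),
    integral_fun_fst (fun x : Fin k → ℝ => x j * x j), integral_eval_stdPi, integral_sq_eval_stdPi]
  · simp
  · exact ((hL.integrable_mul hL).comp_fst _).const_mul _
  · exact ((hL.integrable one_le_two).mul_prod (hL.integrable one_le_two)).const_mul _

variable [NeZero k]

variable (k) in
/-- The expected maximum of `k` independent standard Gaussian variables. -/
def expMax : ℝ := ∫ x, ∑ j, maxInd x j * x j ∂(stdPi k)

lemma memLp_maxInd {α : Type*} [MeasurableSpace α] {P : Measure α} [IsFiniteMeasure P]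
    {f : α → Fin k → ℝ} (hf : Measurable f) (j : Fin k) : MemLp (fun a => maxInd (f a) j) 2 P :=
  MemLp.of_bound ((measurable_maxInd j).comp hf).aestronglyMeasurable 1
    (Filter.Eventually.of_forall fun _ => abs_maxInd_le _ _)

lemma integral_maxInd_mul_snd :
    ∫ p, ∑ j, maxInd (fun i => (p i).1) j * (p j).2 ∂(corrPi k ρ) = ρ * expMax k := by
  have hm : AEStronglyMeasurable (fun p : Fin k → ℝ × ℝ =>
      ∑ j, maxInd (fun i => (p i).1) j * (p j).2)
      (((stdPi k).prod (stdPi k)).map fun q j => (q.1 j, ρ * q.1 j + √(1 - ρ ^ 2) * q.2 j)) := by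
    refine (Finset.measurable_sum _ fun j _ => ?_).aestronglyMeasurable
    exact ((measurable_maxInd j).comp (by fun_prop)).mul (by fun_prop)
  rw [corrPi_eq_map, integral_map (by fun_prop) hm]
  have hi : ∀ j : Fin k, MemLp (fun x : Fin k → ℝ => maxInd x j) 2 (stdPi k) := fun j =>
    memLp_maxInd measurable_id j
  have hA : Integrable (fun x : Fin k → ℝ => ∑ j, maxInd x j * x j) (stdPi k) :=
    integrable_finsetSum _ fun j _ => (hi j).integrable_mul (memLp_eval_stdPi j)
  have hB : ∀ j : Fin k, Integrable (fun q : (Fin k → ℝ) × (Fin k → ℝ) => maxInd q.1 j * q.2 j)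
      ((stdPi k).prod (stdPi k)) := fun j =>
    ((hi j).integrable one_le_two).mul_prod ((memLp_eval_stdPi j).integrable one_le_two)
  have : ∀ q : (Fin k → ℝ) × (Fin k → ℝ),
      ∑ j, maxInd (fun i => q.1 i) j * (ρ * q.1 j + √(1 - ρ ^ 2) * q.2 j) =
      ρ * (∑ j, maxInd q.1 j * q.1 j) + √(1 - ρ ^ 2) * ∑ j, maxInd q.1 j * q.2 j := by
    intro q
    simp only [mul_add, Finset.sum_add_distrib, Finset.mul_sum]
    congr 1 <;> exact Finset.sum_congr rfl fun j _ => by ring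
  simp only [this]
  rw [integral_add ((hA.comp_fst _).const_mul _) ((integrable_finsetSum _ fun j _ => hB j).const_mul _),
    integral_const_mul, integral_const_mul, integral_finsetSum _ fun j _ => hB j,
    integral_fun_fst (fun x : Fin k → ℝ => ∑ j, maxInd x j * x j)]
  have : ∀ j : Fin k, ∫ q, maxInd q.1 j * q.2 j ∂((stdPi k).prod (stdPi k)) = 0 := fun j => by
    rw [integral_prod_mul (fun x : Fin k → ℝ => maxInd x j) (fun x : Fin k → ℝ => x j),
      integral_eval_stdPi, mul_zero]
  simp [this, expMax]

lemma integral_maxInd_mul_fst (h0 : -1 ≤ ρ) (h1 : ρ ≤ 1) :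
    ∫ p, ∑ j, maxInd (fun i => (p i).2) j * (p j).1 ∂(corrPi k ρ) = ρ * expMax k := by
  rw [← integral_maxInd_mul_snd]
  conv_rhs => rw [← (measurePreserving_swap_corrPi k h0 h1).map_eq]
  rw [integral_map (by fun_prop)]
  refine (Finset.measurable_sum _ fun j _ => ?_).aestronglyMeasurable
  exact ((measurable_maxInd j).comp (by fun_prop)).mul (by fun_prop)

end corr

/-! ### The probability of equal argmax as a positive definite kernel -/

section

variable {k : ℕ}

lemma stdPi_tie {i l : Fin k} (h : i ≠ l) : stdPi k {x | x i = x l} = 0 := by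
  have h1 : iIndepFun (fun (i : Fin k) (x : Fin k → ℝ) => x i) (stdPi k) :=
    iIndepFun_pi (X := fun _ => id) (fun _ => aemeasurable_id)
  have h2 := (indepFun_iff_map_prod_eq_prod_map_map (measurable_pi_apply i).aemeasurable
    (measurable_pi_apply l).aemeasurable).1 (h1.indepFun h)
  have h3 : ∀ j : Fin k, (stdPi k).map (fun x => x j) = gaussianReal 0 1 := fun j =>
    (measurePreserving_eval (fun _ : Fin k => gaussianReal 0 1) j).map_eq
  have hd : MeasurableSet {p : ℝ × ℝ | p.1 = p.2} := measurableSet_eq_fun (by fun_prop) (by fun_prop)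
  have h4 : stdPi k {x | x i = x l} =
      ((stdPi k).map fun x => (x i, x l)) {p : ℝ × ℝ | p.1 = p.2} := by
    rw [Measure.map_apply (by fun_prop) hd]; rfl
  have : NullSingletonClass (gaussianReal 0 1) := nullSingletonClass_gaussianReal one_ne_zero
  rw [h4, h2, h3, h3, Measure.measure_prod_null hd]
  refine Filter.Eventually.of_forall fun a => ?_
  have : Prod.mk a ⁻¹' {p : ℝ × ℝ | p.1 = p.2} = {a} := by
    ext b; simp [eq_comm]
  simp [this]

variable [NeZero k]

/-- By symmetry each of `k` independent standard Gaussian variables is the largest with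
probability `1 / k`; ties have probability `0`. -/
lemma integral_maxInd (j : Fin k) : ∫ x, maxInd x j ∂(stdPi k) = 1 / k := by
  -- the event that the entry `j` is strictly larger than all others
  let s : Fin k → Set (Fin k → ℝ) := fun j => {x | ∀ i, i ≠ j → x i < x j}
  have hs : ∀ j, MeasurableSet (s j) := fun j => by
    simp only [s, Set.ofPred_forall]
    exact MeasurableSet.iInter fun i => MeasurableSet.iInter fun _ =>
      measurableSet_lt (measurable_pi_apply _) (measurable_pi_apply _)
  have hae : ∀ j, (fun x => maxInd x j) =ᵐ[stdPi k] (s j).indicator fun _ => 1 := by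
    intro j
    have hn : ∀ᵐ x ∂(stdPi k), ∀ i l : Fin k, i ≠ l → x i ≠ x l := by
      simp only [ae_all_iff]
      exact fun i l h => by simpa [ae_iff] using stdPi_tie h
    filter_upwards [hn] with x hx
    obtain ⟨hlt, hmax⟩ := argmax_spec x
    rw [maxInd_eq]
    by_cases hj : j = ⟨argmax x, hlt⟩
    · have : x ∈ s j := fun i hi => by
        subst hj
        exact lt_of_le_of_ne (hmax i) (hx _ _ hi)
      rw [if_pos hj, Set.indicator_of_mem this]
    · have : x ∉ s j := fun h => absurd (h _ (Ne.symm hj)) (not_lt.2 (hmax j))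
      rw [if_neg hj, Set.indicator_of_notMem this]
  have hsym : ∀ j l, stdPi k (s j) = stdPi k (s l) := by
    intro j l
    have hp := measurePreserving_piCongrLeft (fun _ : Fin k => gaussianReal 0 1) (Equiv.swap j l)
    rw [← hp.measure_preimage (hs l).nullMeasurableSet]
    congr 1
    ext x
    have hx : ∀ i, MeasurableEquiv.piCongrLeft (fun _ : Fin k => ℝ) (Equiv.swap j l) x i =
        x (Equiv.swap j l i) := by
      intro i
      have := MeasurableEquiv.piCongrLeft_apply_apply (β := fun _ : Fin k => ℝ)
        (Equiv.swap j l) x (Equiv.swap j l i)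
      rwa [Equiv.swap_apply_self] at this
    simp only [s, Set.mem_ofPred_eq, Set.mem_preimage, hx, Equiv.swap_apply_right]
    constructor
    · intro h i hi
      exact h _ fun h' => hi (by rw [← Equiv.swap_apply_self j l i, h', Equiv.swap_apply_left])
    · intro h i hi
      have := h (Equiv.swap j l i) fun h' => hi (by
        rw [← Equiv.swap_apply_self j l i, h', Equiv.swap_apply_right])
      rwa [Equiv.swap_apply_self] at this
  have hint : ∀ j, ∫ x, maxInd x j ∂(stdPi k) = (stdPi k).real (s j) := fun j => by
    rw [integral_congr_ae (hae j), integral_indicator (hs j)]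
    simp
  have hsum : ∑ j : Fin k, ∫ x, maxInd x j ∂(stdPi k) = 1 := by
    have hi : ∀ j : Fin k, Integrable (fun x : Fin k → ℝ => maxInd x j) (stdPi k) := fun j =>
      (memLp_maxInd measurable_id j).integrable one_le_two
    rw [← integral_finsetSum _ fun j _ => hi j]
    simp [sum_maxInd]
  have hall : ∀ l, ∫ x, maxInd x l ∂(stdPi k) = ∫ x, maxInd x j ∂(stdPi k) := fun l => by
    rw [hint, hint, measureReal_def, measureReal_def, hsym l j]
  simp only [hall, Finset.sum_const, Finset.card_univ, Fintype.card_fin, nsmul_eq_mul] at hsum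
  have hk : (k : ℝ) ≠ 0 := Nat.cast_ne_zero.2 (NeZero.ne k)
  field_simp
  linarith

variable (k) in
/-- The probability that two standard Gaussian vectors with `k` independent pairs of entries of
correlation `ρ` have their maximum at the same index. -/
def sameProb (ρ : ℝ) : ℝ :=
  ∫ p, (if argmax (fun j => (p j).1) = argmax (fun j => (p j).2) then 1 else 0) ∂(corrPi k ρ)

lemma measurable_same : Measurable fun p : Fin k → ℝ × ℝ =>
    if argmax (fun j => (p j).1) = argmax (fun j => (p j).2) then (1 : ℝ) else 0 :=
  Measurable.ite (measurableSet_eq_fun (measurable_argmax.comp (by fun_prop))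
    (measurable_argmax.comp (by fun_prop))) measurable_const measurable_const

lemma integrable_same {P : Measure (Fin k → ℝ × ℝ)} [IsFiniteMeasure P] :
    Integrable (fun p : Fin k → ℝ × ℝ =>
      if argmax (fun j => (p j).1) = argmax (fun j => (p j).2) then (1 : ℝ) else 0) P :=
  Integrable.of_bound measurable_same.aestronglyMeasurable 1
    (Filter.Eventually.of_forall fun p => by split_ifs <;> simp)

lemma sameProb_le_one (ρ : ℝ) : sameProb k ρ ≤ 1 := by
  refine (integral_mono integrable_same (integrable_const 1) fun p => ?_).trans (by simp)
  dsimp only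
  split_ifs <;> simp

lemma sameProb_zero : sameProb k 0 = 1 / k := by
  rw [sameProb, corrPi_eq_map, integral_map (by fun_prop) measurable_same.aestronglyMeasurable]
  have : ∀ q : (Fin k → ℝ) × (Fin k → ℝ),
      (if argmax (fun j => q.1 j) = argmax (fun j => 0 * q.1 j + √(1 - 0 ^ 2) * q.2 j)
        then (1 : ℝ) else 0) = ∑ j, maxInd q.1 j * maxInd q.2 j := by
    intro q
    rw [sum_maxInd_mul_maxInd]
    simp
  simp only [this]
  have hi : ∀ j : Fin k, Integrable (fun x : Fin k → ℝ => maxInd x j) (stdPi k) := fun j =>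
    (memLp_maxInd measurable_id j).integrable one_le_two
  rw [integral_finsetSum _ fun j _ => (hi j).mul_prod (hi j)]
  have hj : ∀ j : Fin k, ∫ q, maxInd q.1 j * maxInd q.2 j ∂((stdPi k).prod (stdPi k)) =
      1 / k * (1 / k) := fun j => by
    rw [integral_prod_mul (fun x : Fin k → ℝ => maxInd x j) (fun x : Fin k → ℝ => maxInd x j),
      integral_maxInd]
  have hk : (k : ℝ) ≠ 0 := Nat.cast_ne_zero.2 (NeZero.ne k)
  simp only [hj, Finset.sum_const, Finset.card_univ, Fintype.card_fin, nsmul_eq_mul]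
  field_simp

/-- The indicator of a maximum at `j`, minus its projection to the constants and to the `j`-th
coordinate function; the coefficients are `E 1_j = 1 / k` and `E (1_j x_j) = expMax k / k`. -/
def maxIndRes (x : Fin k → ℝ) (j : Fin k) : ℝ :=
  maxInd x j - 1 / k - expMax k / k * x j

lemma memLp_maxIndRes {α : Type*} [MeasurableSpace α] {P : Measure α} [IsFiniteMeasure P]
    {f : α → Fin k → ℝ} (hf : Measurable f) {j : Fin k} (hj : MemLp (fun a => f a j) 2 P) :
    MemLp (fun a => maxIndRes (f a) j) 2 P :=
  ((memLp_maxInd hf j).sub (memLp_const _)).sub (hj.const_mul _)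

lemma sum_maxIndRes (x y : Fin k → ℝ) : ∑ j, maxIndRes x j * maxIndRes y j =
    (if argmax x = argmax y then 1 else 0) - 1 / k - expMax k / k * ∑ j, maxInd x j * y j
      - expMax k / k * ∑ j, maxInd y j * x j + expMax k / k * (1 / k) * ∑ j, x j
      + expMax k / k * (1 / k) * ∑ j, y j + (expMax k / k) ^ 2 * ∑ j, x j * y j := by
  have hk : (k : ℝ) ≠ 0 := Nat.cast_ne_zero.2 (NeZero.ne k)
  rw [← sum_maxInd_mul_maxInd]
  have : ∀ j, maxIndRes x j * maxIndRes y j = maxInd x j * maxInd y j - 1 / k * maxInd x j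
      - 1 / k * maxInd y j + 1 / k * (1 / k) - expMax k / k * (maxInd x j * y j)
      - expMax k / k * (maxInd y j * x j) + expMax k / k * (1 / k) * x j
      + expMax k / k * (1 / k) * y j + (expMax k / k) ^ 2 * (x j * y j) := fun j => by
    unfold maxIndRes; ring
  simp only [this, Finset.sum_add_distrib, Finset.sum_sub_distrib, ← Finset.mul_sum, sum_maxInd]
  simp

lemma integral_sum_maxIndRes {ρ : ℝ} (h0 : -1 ≤ ρ) (h1 : ρ ≤ 1) :
    ∫ p, ∑ j, maxIndRes (fun i => (p i).1) j * maxIndRes (fun i => (p i).2) j ∂(corrPi k ρ) =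
      sameProb k ρ - 1 / k - expMax k ^ 2 / k * ρ := by
  have hk : (k : ℝ) ≠ 0 := Nat.cast_ne_zero.2 (NeZero.ne k)
  have m1 : ∀ j, MemLp (fun p : Fin k → ℝ × ℝ => maxInd (fun i => (p i).1) j) 2 (corrPi k ρ) :=
    fun j => memLp_maxInd (by fun_prop) j
  have m2 : ∀ j, MemLp (fun p : Fin k → ℝ × ℝ => maxInd (fun i => (p i).2) j) 2 (corrPi k ρ) :=
    fun j => memLp_maxInd (by fun_prop) j
  have f1 : ∀ j, MemLp (fun p : Fin k → ℝ × ℝ => (p j).1) 2 (corrPi k ρ) := memLp_fst_corrPi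
  have f2 : ∀ j, MemLp (fun p : Fin k → ℝ × ℝ => (p j).2) 2 (corrPi k ρ) := memLp_snd_corrPi
  have i1 : Integrable (fun p : Fin k → ℝ × ℝ => ∑ j, maxInd (fun i => (p i).1) j * (p j).2)
    (corrPi k ρ) := integrable_finsetSum _ fun j _ => (m1 j).integrable_mul (f2 j)
  have i2 : Integrable (fun p : Fin k → ℝ × ℝ => ∑ j, maxInd (fun i => (p i).2) j * (p j).1)
    (corrPi k ρ) := integrable_finsetSum _ fun j _ => (m2 j).integrable_mul (f1 j)
  have i3 : Integrable (fun p : Fin k → ℝ × ℝ => ∑ j, (p j).1) (corrPi k ρ) :=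
    integrable_finsetSum _ fun j _ => (f1 j).integrable one_le_two
  have i4 : Integrable (fun p : Fin k → ℝ × ℝ => ∑ j, (p j).2) (corrPi k ρ) :=
    integrable_finsetSum _ fun j _ => (f2 j).integrable one_le_two
  have i5 : Integrable (fun p : Fin k → ℝ × ℝ => ∑ j, (p j).1 * (p j).2) (corrPi k ρ) :=
    integrable_finsetSum _ fun j _ => (f1 j).integrable_mul (f2 j)
  have i0 := integrable_same (P := corrPi k ρ)
  have e3 : ∫ p, ∑ j, (p j).1 ∂(corrPi k ρ) = 0 := by
    rw [integral_finsetSum _ fun j _ => (f1 j).integrable one_le_two]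
    simp [integral_fst_corrPi]
  have e4 : ∫ p, ∑ j, (p j).2 ∂(corrPi k ρ) = 0 := by
    rw [integral_finsetSum _ fun j _ => (f2 j).integrable one_le_two]
    simp [integral_snd_corrPi h0 h1]
  have e5 : ∫ p, ∑ j, (p j).1 * (p j).2 ∂(corrPi k ρ) = k * ρ := by
    have hi : ∀ j : Fin k, Integrable (fun p : Fin k → ℝ × ℝ => (p j).1 * (p j).2) (corrPi k ρ) :=
      fun j => (f1 j).integrable_mul (f2 j)
    rw [integral_finsetSum _ fun j _ => hi j]
    simp [integral_mul_corrPi]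
  simp only [sum_maxIndRes]
  have j1 := i0.sub (integrable_const (1 / (k : ℝ)))
  have j2 := j1.sub (i1.const_mul (expMax k / k))
  have j3 := j2.sub (i2.const_mul (expMax k / k))
  have j4 := j3.add (i3.const_mul (expMax k / k * (1 / k)))
  have j5 := j4.add (i4.const_mul (expMax k / k * (1 / k)))
  refine (integral_add j5 (i5.const_mul ((expMax k / k) ^ 2))).trans ?_
  rw [integral_add' j4 (i4.const_mul _), integral_add' j3 (i3.const_mul _),
    integral_sub' j2 (i2.const_mul _), integral_sub' j1 (i1.const_mul _),
    integral_sub' i0 (integrable_const _)]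
  simp only [integral_const_mul, e3, e4, e5, integral_maxInd_mul_snd, integral_maxInd_mul_fst h0 h1]
  simp [sameProb]
  field_simp
  ring

end

/-! ### Bounds for the probability of equal argmax -/

lemma memLp_inner_pi {k : ℕ} {E : Type*} [NormedAddCommGroup E] [InnerProductSpace ℝ E]
    [FiniteDimensional ℝ E] [MeasurableSpace E] [BorelSpace E] {v : E} (hv : ‖v‖ = 1) (j : Fin k) :
    MemLp (fun g : Fin k → E => inner ℝ (g j) v) 2 (Measure.pi fun _ => stdGaussian E) := by
  have h := memLp_fst_corrPi (ρ := inner ℝ v v) j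
  rw [← map_inner_inner_pi k hv hv, memLp_map_measure_iff
    (by fun_prop : Measurable _).aestronglyMeasurable (by fun_prop)] at h
  exact h

section

variable {k : ℕ} [NeZero k]

/-- The kernel `sameProb k`, reduced by its terms of degree `0` and `1`, is positive definite: it is
the Gram kernel of the residual indicators `maxIndRes`. -/
lemma spherePosDef_sameProb :
    SpherePosDef fun ρ => sameProb k ρ - 1 / k - expMax k ^ 2 / k * ρ := by
  intro ι _ _ M hM hd c
  obtain ⟨v, hv⟩ := exists_gram_eq hM
  have hn : ∀ a, ‖v a‖ = 1 := fun a => by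
    rw [← sq_eq_sq₀ (norm_nonneg _) zero_le_one, ← real_inner_self_eq_norm_sq, hv, hd, one_pow]
  let E := EuclideanSpace ℝ ι
  let G : Measure (Fin k → E) := Measure.pi fun _ => stdGaussian E
  let R : ι → Fin k → (Fin k → E) → ℝ := fun a j g => maxIndRes (fun i => inner ℝ (g i) (v a)) j
  have hR : ∀ a j, MemLp (R a j) 2 G := fun a j =>
    memLp_maxIndRes (by fun_prop) (memLp_inner_pi (hn a) j)
  have hRR : ∀ a b j, Integrable (fun g => R a j g * R b j g) G := fun a b j =>
    (hR a j).integrable_mul (hR b j)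
  have key : ∀ a b, sameProb k (M a b) - 1 / k - expMax k ^ 2 / k * M a b =
      ∫ g, ∑ j, R a j g * R b j g ∂G := by
    intro a b
    have h1 := abs_real_inner_le_norm (v a) (v b)
    rw [hn, hn, one_mul, hv, abs_le] at h1
    rw [← integral_sum_maxIndRes h1.1 h1.2, ← hv, ← map_inner_inner_pi k (hn a) (hn b),
      integral_map (by fun_prop)]
    refine (Finset.measurable_sum _ fun j _ => ?_).aestronglyMeasurable
    have hm : ∀ j, Measurable fun x : Fin k → ℝ => maxIndRes x j := fun j =>
      ((measurable_maxInd j).sub_const _).sub ((measurable_pi_apply j).const_mul _)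
    exact ((hm j).comp (by fun_prop)).mul ((hm j).comp (by fun_prop))
  simp only [key]
  have e : ∑ a, ∑ b, c a * c b * ∫ g, ∑ j, R a j g * R b j g ∂G =
      ∫ g, ∑ a, ∑ b, c a * c b * ∑ j, R a j g * R b j g ∂G := by
    have hi : ∀ a b, Integrable (fun g => c a * c b * ∑ j, R a j g * R b j g) G := fun a b =>
      (integrable_finsetSum _ fun j _ => hRR a b j).const_mul _
    rw [integral_finsetSum _ fun a _ => integrable_finsetSum _ fun b _ => hi a b]
    refine Finset.sum_congr rfl fun a _ => ?_
    rw [integral_finsetSum _ fun b _ => hi a b]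
    exact Finset.sum_congr rfl fun b _ => (integral_const_mul _ _).symm
  rw [e]
  refine integral_nonneg fun g => ?_
  have : ∑ a, ∑ b, c a * c b * ∑ j, R a j g * R b j g = ∑ j, (∑ a, c a * R a j g) ^ 2 := by
    simp only [sq, Finset.sum_mul_sum]
    conv_rhs => rw [Finset.sum_comm]
    refine Finset.sum_congr rfl fun a _ => ?_
    conv_rhs => rw [Finset.sum_comm]
    refine Finset.sum_congr rfl fun b _ => ?_
    rw [Finset.mul_sum]
    exact Finset.sum_congr rfl fun j _ => by ring
  simp only [Pi.zero_apply, this]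
  positivity

lemma expMax_sq_div_le : expMax k ^ 2 / k ≤ 1 - 1 / k := by
  have h := (spherePosDef_sameProb (k := k)).nonneg zero_le_one le_rfl
  linarith [sameProb_le_one (k := k) 1]

lemma sameProb_le_of_nonneg {ρ : ℝ} (h0 : 0 ≤ ρ) (h1 : ρ ≤ 1) :
    sameProb k ρ ≤ 1 / k + (1 - 1 / k) * ρ := by
  have h := (spherePosDef_sameProb (k := k)).le_chord h0 h1
  simp only [sameProb_zero] at h
  have := mul_le_mul_of_nonneg_left (sameProb_le_one (k := k) 1) h0
  linarith

lemma sameProb_neg_le {s : ℝ} (h0 : 0 ≤ s) (h1 : s ≤ 1) :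
    sameProb k (-s) ≤ 1 / k - expMax k ^ 2 / k * s + 2 * s ^ 2 := by
  have h := (spherePosDef_sameProb (k := k)).neg_le (by simp [sameProb_zero]) h0 h1
  have h2 : sameProb k 1 - 1 / k - expMax k ^ 2 / k * 1 ≤ 1 := by
    have : 0 ≤ expMax k ^ 2 / k := by positivity
    have : (0 : ℝ) ≤ 1 / k := by positivity
    linarith [sameProb_le_one (k := k) 1]
  have := mul_le_mul_of_nonneg_left h2 (show 0 ≤ 2 * s ^ 2 by positivity)
  linarith

end

/-- The factor by which the expected number of conflicts after Frieze-Jerrum rounding can exceed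
the value of the vector program. -/
def fjFactor (k : ℕ) : ℝ := 2 - 1 / k - expMax k ^ 2 / k + 2 / ((k : ℝ) - 1)

lemma one_le_fjFactor {k : ℕ} (hk : 2 ≤ k) : 1 ≤ fjFactor k := by
  have : NeZero k := ⟨by omega⟩
  have h2 : (2 : ℝ) ≤ k := by exact_mod_cast hk
  have := expMax_sq_div_le (k := k)
  have : 0 ≤ 2 / ((k : ℝ) - 1) := div_nonneg (by norm_num) (by linarith)
  unfold fjFactor
  linarith

/-- An affine majorant of `sameProb k` on `[-1 / (k - 1), 1]` with value `1` at `1`. On `[-1/(k-1), 0]`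
the bound for `sameProb k` is convex, so that the end points decide. -/
lemma sameProb_le {k : ℕ} (hk : 2 ≤ k) {ρ : ℝ} (h0 : -1 / ((k : ℝ) - 1) ≤ ρ) (h1 : ρ ≤ 1) :
    sameProb k ρ ≤ fjFactor k / k + (1 - fjFactor k / k) * ρ := by
  have : NeZero k := ⟨by omega⟩
  have h2 : (2 : ℝ) ≤ k := by exact_mod_cast hk
  have hk0 : (0 : ℝ) < k := by linarith
  have hA : 1 / k ≤ fjFactor k / k := div_le_div_of_nonneg_right (one_le_fjFactor hk) hk0.le
  set A := fjFactor k / k with hAdef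
  rcases le_total 0 ρ with h | h
  · have := sameProb_le_of_nonneg (k := k) h h1
    have := mul_le_mul_of_nonneg_right hA (show 0 ≤ 1 - ρ by linarith)
    linarith
  · have hk1 : (0 : ℝ) < k - 1 := by linarith
    set b := 1 / ((k : ℝ) - 1) with hb
    have hb0 : 0 ≤ b := by positivity
    have hsb : -ρ ≤ b := by
      rw [hb]; rw [neg_div] at h0; linarith
    have hb1 : b ≤ 1 := by rw [hb, div_le_one hk1]; linarith
    have h3 := sameProb_neg_le (k := k) (s := -ρ) (by linarith) (by linarith)
    rw [neg_neg] at h3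
    have hAeq : A - (1 - A) * b = 1 / k - expMax k ^ 2 / k * b + 2 * b ^ 2 := by
      rw [hAdef, fjFactor, hb]
      field_simp
      ring
    set a := expMax k ^ 2 / k
    -- `-ρ = λ b` with `λ ∈ [0, 1]`, and the square is below its chord
    have hsq : ρ ^ 2 ≤ b * (-ρ) := by nlinarith
    have hbp : 0 < b := by positivity
    have : b * (1 / k + a * ρ + 2 * ρ ^ 2) ≤ b * (A + (1 - A) * ρ) := by
      nlinarith [mul_nonneg (sub_nonneg.2 hsb) (sub_nonneg.2 hA), mul_nonneg hb0 (sub_nonneg.2 hsq)]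
    have := le_of_mul_le_mul_left this hbp
    nlinarith

/-! ### Separation by a random hyperplane -/

/-- The probability that two standard Gaussian variables of correlation `ρ` have different signs. -/
def sepProb (ρ : ℝ) : ℝ := (corrGaussian ρ).real {p | ¬ (0 ≤ p.1 ↔ 0 ≤ p.2)}

section

variable {E : Type*} [NormedAddCommGroup E] [InnerProductSpace ℝ E] [FiniteDimensional ℝ E]
  [MeasurableSpace E] [BorelSpace E]

lemma measurableSet_sep {α : Type*} [MeasurableSpace α] {f g : α → ℝ} (hf : Measurable f)
    (hg : Measurable g) : MeasurableSet {a | ¬ (0 ≤ f a ↔ 0 ≤ g a)} :=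
  (MeasurableSet.iff (measurableSet_le measurable_const hf)
    (measurableSet_le measurable_const hg)).compl

lemma stdGaussian_real_sep {u v : E} (hu : ‖u‖ = 1) (hv : ‖v‖ = 1) :
    (stdGaussian E).real {r | ¬ (0 ≤ (inner ℝ r u : ℝ) ↔ 0 ≤ (inner ℝ r v : ℝ))} =
      sepProb (inner ℝ u v) := by
  rw [sepProb, ← map_inner_inner_stdGaussian hu hv, measureReal_def, measureReal_def,
    Measure.map_apply (by fun_prop) (measurableSet_sep (by fun_prop) (by fun_prop))]
  rfl

lemma stdGaussian_inner_eq_zero {u : E} (hu : ‖u‖ = 1) :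
    stdGaussian E {r | (inner ℝ r u : ℝ) = 0} = 0 := by
  have h0 : MeasurableSet {p : ℝ × ℝ | p.1 = 0} :=
    measurableSet_eq_fun (by fun_prop) (by fun_prop)
  have h1 : stdGaussian E {r | (inner ℝ r u : ℝ) = 0} =
      corrGaussian (inner ℝ u u) {p : ℝ × ℝ | p.1 = 0} := by
    rw [← map_inner_inner_stdGaussian hu hu, Measure.map_apply (by fun_prop) h0]
    rfl
  have : NullSingletonClass (gaussianReal 0 1) := nullSingletonClass_gaussianReal one_ne_zero
  rw [h1, corrGaussian, Measure.map_apply (by fun_prop) h0]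
  have : (fun p : ℝ × ℝ => (p.1, inner ℝ u u * p.1 + √(1 - inner ℝ u u ^ 2) * p.2)) ⁻¹'
      {p : ℝ × ℝ | p.1 = 0} = {0} ×ˢ Set.univ := by
    ext p; simp
  rw [this, Measure.prod_prod]
  simp

end

lemma sepProb_nonneg (ρ : ℝ) : 0 ≤ sepProb ρ := measureReal_nonneg

lemma sepProb_add_sepProb_neg {ρ : ℝ} (h0 : -1 ≤ ρ) (h1 : ρ ≤ 1) :
    sepProb ρ + sepProb (-ρ) = 1 := by
  obtain ⟨u, v, hu, hv, rfl⟩ := exists_inner_eq_of_abs_le h0 h1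
  rw [← inner_neg_right, ← stdGaussian_real_sep hu hv, ← stdGaussian_real_sep hu (by simpa using hv)]
  set P := stdGaussian (EuclideanSpace ℝ (Fin 2))
  have hm : MeasurableSet {r : EuclideanSpace ℝ (Fin 2) |
      ¬ (0 ≤ (inner ℝ r u : ℝ) ↔ 0 ≤ (inner ℝ r v : ℝ))} :=
    measurableSet_sep (by fun_prop) (by fun_prop)
  have hae : ({r | ¬ (0 ≤ (inner ℝ r u : ℝ) ↔ 0 ≤ (inner ℝ r (-v) : ℝ))} : Set _) =ᵐ[P]
      ({r | ¬ (0 ≤ (inner ℝ r u : ℝ) ↔ 0 ≤ (inner ℝ r v : ℝ))}ᶜ : Set _) := by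
    have hn : ∀ᵐ r ∂P, (inner ℝ r v : ℝ) ≠ 0 := by
      simpa [ae_iff] using stdGaussian_inner_eq_zero hv
    filter_upwards [hn] with r hr
    apply propext
    change ¬ (_ ↔ _) ↔ ¬ ¬ (_ ↔ _)
    rw [inner_neg_right, neg_nonneg, not_not]
    rcases lt_or_gt_of_ne hr with h | h
    · simp [h.le, not_le.2 h]
    · simp [h.le, not_le.2 h]
  rw [measureReal_congr hae, probReal_compl_eq_one_sub hm]
  ring

lemma sepProb_one : sepProb 1 = 0 := by
  obtain ⟨u, v, hu, -, -⟩ := exists_inner_eq_of_abs_le (ρ := 1) (by norm_num) le_rfl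
  have h := stdGaussian_real_sep hu hu
  rw [real_inner_self_eq_norm_sq, hu, one_pow] at h
  rw [← h]
  simp

lemma sepProb_zero : sepProb 0 = 1 / 2 := by
  have := sepProb_add_sepProb_neg (ρ := 0) (by norm_num) (by norm_num)
  rw [neg_zero] at this
  linarith

/-- A random hyperplane separates two vectors at angle `α + β < π` if and only if it separates
exactly one of them from the vector between them. -/
lemma sepProb_cos_add {α β : ℝ} (hα : 0 ≤ α) (hβ : 0 ≤ β) (h : α + β < Real.pi) :
    sepProb (Real.cos (α + β)) = sepProb (Real.cos α) + sepProb (Real.cos β) := by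
  rcases (add_nonneg hα hβ).eq_or_lt with h0 | h0
  · have ha : α = 0 := by linarith
    have hb : β = 0 := by linarith
    simp [ha, hb, sepProb_one]
  let e : ℝ → EuclideanSpace ℝ (Fin 2) := fun t => !₂[Real.cos t, Real.sin t]
  have hn : ∀ t, ‖e t‖ = 1 := fun t => by
    simp [e, EuclideanSpace.norm_eq, Fin.sum_univ_two]
  have hin : ∀ s t, inner ℝ (e s) (e t) = Real.cos (t - s) := fun s t => by
    simp [e, PiLp.inner_apply, Fin.sum_univ_two, Real.cos_sub]
  have e1 := stdGaussian_real_sep (hn 0) (hn (α + β))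
  have e2 := stdGaussian_real_sep (hn 0) (hn α)
  have e3 := stdGaussian_real_sep (hn α) (hn (α + β))
  rw [hin, sub_zero] at e1 e2
  rw [hin, add_sub_cancel_left] at e3
  rw [← e1, ← e2, ← e3]
  have hs : 0 < Real.sin (α + β) := Real.sin_pos_of_pos_of_lt_pi h0 h
  have hsa : 0 ≤ Real.sin α := Real.sin_nonneg_of_nonneg_of_le_pi hα (by linarith)
  have hsb : 0 ≤ Real.sin β := Real.sin_nonneg_of_nonneg_of_le_pi hβ (by linarith)
  have hsab : 0 < Real.sin α + Real.sin β := by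
    rw [Real.sin_add] at hs
    by_contra hc
    have ha : Real.sin α = 0 := by linarith
    have hb : Real.sin β = 0 := by linarith
    simp [ha, hb] at hs
  have hcomb : ∀ r, Real.sin (α + β) * inner ℝ r (e α) =
      Real.sin β * inner ℝ r (e 0) + Real.sin α * inner ℝ r (e (α + β)) := fun r => by
    simp only [e, PiLp.inner_apply, Fin.sum_univ_two, RCLike.inner_apply, conj_trivial]
    simp only [Real.cos_zero, Real.sin_zero, Matrix.cons_val_zero, Matrix.cons_val_one]
    rw [Real.cos_add, Real.sin_add]
    have := Real.sin_sq_add_cos_sq α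
    linear_combination (Real.sin β * r.ofLp 0) * this
  have hpp : ∀ r, 0 ≤ inner ℝ r (e 0) → 0 ≤ inner ℝ r (e (α + β)) → 0 ≤ inner ℝ r (e α) := by
    intro r h1 h2
    have := hcomb r
    by_contra hc
    have : Real.sin (α + β) * inner ℝ r (e α) < 0 := mul_neg_of_pos_of_neg hs (not_le.1 hc)
    have := mul_nonneg hsb h1
    have := mul_nonneg hsa h2
    linarith
  have hnn : ∀ r, inner ℝ r (e 0) < 0 → inner ℝ r (e (α + β)) < 0 → inner ℝ r (e α) < 0 := by
    intro r h1 h2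
    have := hcomb r
    by_contra hc
    have := mul_nonneg hs.le (not_lt.1 hc)
    rcases hsa.eq_or_lt with ha | ha
    · have := mul_neg_of_pos_of_neg (show 0 < Real.sin β by linarith) h1
      rw [← ha] at hcomb
      linarith [hcomb r]
    · have := mul_neg_of_pos_of_neg ha h2
      have := mul_nonpos_of_nonneg_of_nonpos hsb h1.le
      linarith
  rw [← measureReal_union _ (measurableSet_sep (by fun_prop) (by fun_prop))]
  · congr 1
    ext r
    change ¬ (_ ↔ _) ↔ (¬ (_ ↔ _) ∨ ¬ (_ ↔ _))
    have h1 := hpp r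
    have h2 := hnn r
    simp only [← not_le] at h2
    tauto
  · rw [Set.disjoint_left]
    intro r h1 h2
    change ¬ (_ ↔ _) at h1
    change ¬ (_ ↔ _) at h2
    have h3 := hpp r
    have h4 := hnn r
    simp only [← not_le] at h4
    tauto

lemma sepProb_cos_nat_mul {α : ℝ} (hα : 0 ≤ α) (n : ℕ) (h : n * α < Real.pi) :
    sepProb (Real.cos (n * α)) = n * sepProb (Real.cos α) := by
  induction n with
  | zero => simp [sepProb_one]
  | succ n ih =>
    push_cast at h ⊢
    have e : (n + 1 : ℝ) * α = n * α + α := by ring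
    rw [e] at h ⊢
    rw [sepProb_cos_add (by positivity) hα h, ih (by linarith)]
    ring

/-- The separation probability is at least the angle divided by `π` (in fact equal to it): it is
additive and monotone in the angle and equals `1 / 2` at `π / 2`. -/
lemma div_pi_le_sepProb_cos {θ : ℝ} (h0 : 0 ≤ θ) (h1 : θ ≤ Real.pi) :
    θ / Real.pi ≤ sepProb (Real.cos θ) := by
  have hpi := Real.pi_pos
  rcases h1.eq_or_lt with rfl | h1
  · have := sepProb_add_sepProb_neg (ρ := 1) (by norm_num) le_rfl
    rw [sepProb_one, zero_add] at this
    rw [Real.cos_pi, this, div_self hpi.ne']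
  have key : ∀ n : ℕ, θ / Real.pi - sepProb (Real.cos θ) ≤ 1 / 2 * (1 / ((n : ℝ) + 1)) := by
    intro n
    set α := Real.pi / (2 * (n + 1)) with hα
    have hα0 : 0 < α := by positivity
    have hd : sepProb (Real.cos α) = 1 / (2 * (n + 1)) := by
      have e : ((n + 1 : ℕ) : ℝ) * α = Real.pi / 2 := by rw [hα]; push_cast; field_simp
      have := sepProb_cos_nat_mul hα0.le (n + 1) (by rw [e]; linarith)
      rw [e, Real.cos_pi_div_two, sepProb_zero] at this
      push_cast at this
      field_simp at this ⊢
      linarith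
    have hf := Nat.floor_le (show 0 ≤ θ / α by positivity)
    have hf2 := Nat.lt_floor_add_one (θ / α)
    set j := ⌊θ / α⌋₊
    have hj : j * α ≤ θ := by rwa [le_div_iff₀ hα0] at hf
    have h3 := sepProb_cos_add (α := j * α) (β := θ - j * α) (by positivity) (by linarith)
      (by linarith)
    rw [add_sub_cancel, sepProb_cos_nat_mul hα0.le j (by linarith), hd] at h3
    have h4 := sepProb_nonneg (Real.cos (θ - j * α))
    have e5 : θ / Real.pi = θ / α * (1 / (2 * (n + 1))) := by
      rw [hα]; field_simp
    have h6 : θ / α * (1 / (2 * ((n : ℝ) + 1))) ≤ (j + 1) * (1 / (2 * (n + 1))) :=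
      mul_le_mul_of_nonneg_right hf2.le (by positivity)
    have e7 : 1 / 2 * (1 / ((n : ℝ) + 1)) = 1 / (2 * (n + 1)) := by field_simp
    rw [e5, h3, e7]
    linarith
  have lim := tendsto_one_div_add_atTop_nhds_zero_nat (𝕜 := ℝ).const_mul (1 / 2)
  rw [mul_zero] at lim
  have := ge_of_tendsto' lim key
  linarith

/-- The Goemans-Williamson inequality with the constant `0.878`. -/
lemma goemansWilliamson_le {θ : ℝ} (h0 : 0 ≤ θ) (h1 : θ ≤ Real.pi) :
    0.439 * (1 - Real.cos θ) ≤ θ / Real.pi := by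
  have hpi := Real.pi_pos
  have hlo := Real.pi_gt_d4
  have hhi := Real.pi_lt_d4
  rcases le_total θ (Real.pi / 2) with h | h
  · have h2 := Real.one_sub_mul_le_cos h0 h
    have e : 2 / Real.pi * θ = 2 * (θ / Real.pi) := by ring
    have : 0 ≤ θ / Real.pi := by positivity
    rw [e] at h2
    linarith
  -- expand at `3 π / 4`, close to the angle at which the inequality is tightest
  obtain ⟨x, hθ⟩ : ∃ x, θ = x + 3 * Real.pi / 4 := ⟨θ - 3 * Real.pi / 4, by ring⟩
  have hxl : -(4 / 5) ≤ x := by linarith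
  have hxu : x ≤ 4 / 5 := by linarith
  have hc : Real.cos θ = -(√2 / 2) * (Real.cos x + Real.sin x) := by
    rw [hθ, show x + 3 * Real.pi / 4 = (x - Real.pi / 4) + Real.pi by ring, Real.cos_add_pi,
      Real.cos_sub, Real.cos_pi_div_four, Real.sin_pi_div_four]
    ring
  have hdiv : θ / Real.pi = 3 / 4 + x * (1 / Real.pi) := by
    rw [hθ]; field_simp; ring
  have hs2 : √2 / 2 ≤ 0.70711 := by
    have : √2 ≤ 1.41422 := Real.sqrt_le_iff.2 ⟨by norm_num, by norm_num⟩
    linarith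
  have hs0 : 0 ≤ √2 / 2 := by positivity
  have hpi1 : 1 / Real.pi ≤ 0.3184 := by
    rw [div_le_iff₀ hpi]; linarith
  have hpi2 : 0.318 ≤ 1 / Real.pi := by
    rw [le_div_iff₀ hpi]; linarith
  have hcos : Real.cos x ≤ 1 - x ^ 2 / 2 + x ^ 4 * (5 / 96) := by
    have := (abs_le.1 (Real.cos_bound (x := x) (abs_le.2 ⟨by linarith, by linarith⟩))).2
    rw [(show Even 4 from ⟨2, rfl⟩).pow_abs] at this
    linarith
  rw [hc, hdiv]
  have hmain : ∀ B : ℝ, Real.cos x + Real.sin x ≤ B → 0 ≤ B →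
      0.439 * (1 + 0.70711 * B) ≤ 3 / 4 + x * (1 / Real.pi) →
      0.439 * (1 - -(√2 / 2) * (Real.cos x + Real.sin x)) ≤ 3 / 4 + x * (1 / Real.pi) := by
    intro B hB hB0 h
    have a1 := mul_le_mul_of_nonneg_left hB hs0
    have a2 := mul_le_mul_of_nonneg_right hs2 hB0
    linarith
  rcases le_total 0 x with hx0 | hx0
  · refine hmain (1 + x - x ^ 2 / 2 + x ^ 4 * (5 / 96)) ?_ ?_ ?_
    · linarith [Real.sin_le hx0]
    · nlinarith [sq_nonneg (x ^ 2)]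
    · have := mul_le_mul_of_nonneg_left hpi2 hx0
      have : x ^ 4 ≤ x ^ 2 := pow_le_pow_of_le_one hx0 (by linarith) (by norm_num)
      nlinarith [sq_nonneg x]
  · obtain ⟨y, rfl⟩ : ∃ y, x = -y := ⟨-x, by ring⟩
    have hy0 : 0 ≤ y := by linarith
    have hy1 : y ≤ 4 / 5 := by linarith
    have hsin : Real.sin (-y) ≤ -y + y ^ 3 / 4 := by
      rcases hy0.eq_or_lt with rfl | hy
      · simp
      · rw [Real.sin_neg]
        linarith [Real.sin_gt_sub_cube hy, pow_pos hy 3]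
    refine hmain (1 - y - y ^ 2 / 2 + y ^ 3 / 4 + y ^ 4 * (5 / 96)) ?_ ?_ ?_
    · have e1 : (-y) ^ 2 = y ^ 2 := by ring
      have e2 : (-y) ^ 4 = y ^ 4 := by ring
      rw [e1, e2] at hcos
      linarith
    · have h5 : 0 ≤ 1.24 + 0.3 * y - 0.25 * y ^ 2 := by nlinarith
      have h6 := mul_nonneg (sub_nonneg.2 hy1) h5
      have h7 : 0 ≤ y ^ 4 := by positivity
      linarith
    · have := mul_le_mul_of_nonneg_left hpi1 hy0
      have h3 : y ^ 3 ≤ 4 / 5 * y ^ 2 := by nlinarith [sq_nonneg y]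
      have h4 : y ^ 4 ≤ 4 / 5 * y ^ 2 := by nlinarith [sq_nonneg y]
      nlinarith [sq_nonneg (y - 0.0254)]

/-! ### The expected maximum of Gaussian variables -/

lemma integral_abs_eval_stdPi_le {k : ℕ} (j : Fin k) : ∫ x, |x j| ∂(stdPi k) ≤ 1 := by
  have hL := memLp_eval_stdPi j
  have hi : Integrable (fun x : Fin k → ℝ => (1 + x j * x j) / 2) (stdPi k) :=
    ((integrable_const 1).add (hL.integrable_mul hL)).div_const 2
  have h2 : Integrable (fun x : Fin k → ℝ => x j * x j) (stdPi k) := hL.integrable_mul hL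
  have h3 : ∫ x, (1 + x j * x j) / 2 ∂(stdPi k) = 1 := by
    rw [integral_div, integral_add (integrable_const 1) h2, integral_sq_eval_stdPi]
    simp
  rw [← h3]
  refine integral_mono (hL.integrable one_le_two).abs hi fun x => ?_
  dsimp only
  have h4 := sq_nonneg (|x j| - 1)
  have h5 := abs_mul_abs_self (x j)
  nlinarith

/-- A lower bound for the expected maximum: the maximum is at least `t` if some variable reaches `t`,
and in any case at least the first variable. -/
lemma le_expMax {k : ℕ} [NeZero k] (t : ℝ) :
    t * (1 - (gaussianReal 0 1).real (Set.Iio t) ^ k) - 1 ≤ expMax k := by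
  let s : Set (Fin k → ℝ) := Set.univ.pi fun _ => Set.Iio t
  have hs : MeasurableSet s := MeasurableSet.univ_pi fun _ => measurableSet_Iio
  have h1 : (stdPi k).real s = (gaussianReal 0 1).real (Set.Iio t) ^ k := by
    simp only [s, measureReal_def, Measure.pi_pi]
    simp
  have h0 := (memLp_eval_stdPi (0 : Fin k)).integrable one_le_two
  have hi : Integrable (fun x : Fin k → ℝ => sᶜ.indicator (fun _ => t) x - |x 0|) (stdPi k) :=
    ((integrable_const t).indicator hs.compl).sub h0.abs
  have hmax : Integrable (fun x : Fin k → ℝ => ∑ j, maxInd x j * x j) (stdPi k) :=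
    integrable_finsetSum _ fun j _ =>
      (memLp_maxInd (f := fun x => x) measurable_id j).integrable_mul (memLp_eval_stdPi j)
  calc t * (1 - (gaussianReal 0 1).real (Set.Iio t) ^ k) - 1
      ≤ t * (1 - (stdPi k).real s) - ∫ x, |x 0| ∂(stdPi k) := by
        rw [h1]; linarith [integral_abs_eval_stdPi_le (0 : Fin k)]
    _ = ∫ x, (sᶜ.indicator (fun _ => t) x - |x 0|) ∂(stdPi k) := by
        rw [integral_sub ((integrable_const t).indicator hs.compl) h0.abs,
          integral_indicator hs.compl]
        simp [probReal_compl_eq_one_sub hs, mul_comm]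
    _ ≤ expMax k := by
        refine integral_mono hi hmax fun x => ?_
        obtain ⟨hlt, hm⟩ := argmax_spec x
        simp only [sum_maxInd_mul]
        by_cases hx : x ∈ s
        · rw [Set.indicator_of_notMem (by simpa using hx)]
          linarith [hm 0, neg_abs_le (x 0)]
        · rw [Set.indicator_of_mem (by simpa using hx)]
          simp only [s, Set.mem_univ_pi, Set.mem_Iio, not_forall, not_lt] at hx
          obtain ⟨i, hti⟩ := hx
          linarith [hm i, abs_nonneg (x 0)]

lemma gaussianReal_Iio_le {t : ℝ} (ht : 0 ≤ t) :
    (gaussianReal 0 1).real (Set.Iio t) ≤ 1 - Real.exp (-(t + 1) ^ 2 / 2) / 3 := by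
  have hpi : √(2 * Real.pi) ≤ 3 := Real.sqrt_le_iff.2 ⟨by norm_num, by linarith [Real.pi_lt_d2]⟩
  have h1 : Real.exp (-(t + 1) ^ 2 / 2) / 3 ≤ (gaussianReal 0 1).real (Set.Icc t (t + 1)) := by
    rw [measureReal_def, gaussianReal_apply_eq_integral 0 one_ne_zero, ENNReal.toReal_ofReal
      (integral_nonneg fun x => gaussianPDFReal_nonneg _ _ _)]
    have h2 : ∫ _ in Set.Icc t (t + 1), Real.exp (-(t + 1) ^ 2 / 2) / 3 =
        Real.exp (-(t + 1) ^ 2 / 2) / 3 := by simp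
    rw [← h2]
    refine setIntegral_mono_on (by simp) (integrable_gaussianPDFReal 0 1).integrableOn
      measurableSet_Icc fun x hx => ?_
    have h3 : -(t + 1) ^ 2 / 2 ≤ -(x - 0) ^ 2 / (2 * 1) := by
      have : 0 ≤ x := ht.trans hx.1
      nlinarith [hx.2]
    rw [gaussianPDFReal, div_eq_inv_mul]
    refine mul_le_mul ?_ (Real.exp_le_exp.2 (by simpa using h3)) (Real.exp_pos _).le (by positivity)
    refine inv_anti₀ (by positivity) (by simpa using hpi)
  have h4 : (gaussianReal 0 1).real (Set.Iio t) =
      1 - (gaussianReal 0 1).real (Set.Ici t) := by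
    rw [← probReal_compl_eq_one_sub measurableSet_Ici, Set.compl_Ici]
  have h5 : (gaussianReal 0 1).real (Set.Icc t (t + 1)) ≤ (gaussianReal 0 1).real (Set.Ici t) :=
    measureReal_mono Set.Icc_subset_Ici_self
  linarith

/-- The expected maximum of `k` standard Gaussian variables is `√(2 ln k)` up to a constant. The
threshold in `le_expMax` is `√(2 ln k) - 2`. -/
lemma sqrt_sub_le_expMax {k : ℕ} [NeZero k] (h : 2 ≤ √(2 * Real.log k)) :
    √(2 * Real.log k) - 6 ≤ expMax k := by
  set T := √(2 * Real.log k) with hT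
  have hk : (0 : ℝ) < k := Nat.cast_pos.2 (NeZero.pos k)
  have hlog : 0 ≤ 2 * Real.log k := by
    by_contra hc
    rw [hT, Real.sqrt_eq_zero_of_nonpos (by linarith)] at h
    linarith
  have hT2 : T ^ 2 = 2 * Real.log k := Real.sq_sqrt hlog
  set q := (gaussianReal 0 1).real (Set.Iio (T - 2)) with hq
  have hq0 : 0 ≤ q := measureReal_nonneg
  set p := Real.exp (-(T - 2 + 1) ^ 2 / 2) / 3 with hp
  have hqp : q ≤ 1 - p := gaussianReal_Iio_le (by linarith)
  have hkp : k * p = Real.exp (T - 1 / 2) / 3 := by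
    have : (k : ℝ) * Real.exp (-(T - 2 + 1) ^ 2 / 2) = Real.exp (T - 1 / 2) := by
      conv_lhs => rw [← Real.exp_log hk]
      rw [← Real.exp_add]
      congr 1
      linear_combination (1 / 2) * hT2.symm
    rw [hp, ← this]; ring
  have hTe : T ≤ Real.exp (T - 1 / 2) := by linarith [Real.add_one_le_exp (T - 1 / 2)]
  have hqk : q ^ k ≤ Real.exp (-(k * p)) := by
    calc q ^ k ≤ Real.exp (-p) ^ k :=
          pow_le_pow_left₀ hq0 (hqp.trans (by linarith [Real.add_one_le_exp (-p)])) k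
      _ = Real.exp (-(k * p)) := by rw [← Real.exp_nat_mul]; ring_nf
  have hfin : T * q ^ k ≤ 3 := by
    have h1 : T / 3 ≤ k * p := by rw [hkp]; linarith
    have h2 : T / 3 * Real.exp (-(k * p)) ≤ 1 := by
      have h3 : k * p ≤ Real.exp (k * p) := by linarith [Real.add_one_le_exp (k * p)]
      rw [Real.exp_neg, ← div_eq_mul_inv, div_le_one (Real.exp_pos _)]
      linarith
    have := mul_le_mul_of_nonneg_left hqk (show 0 ≤ T by linarith)
    linarith
  have := le_expMax (k := k) (T - 2)
  have hqk0 : 0 ≤ q ^ k := by positivity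
  rw [← hq] at this
  linarith

lemma tendsto_log_natCast : Tendsto (fun k : ℕ => Real.log k) atTop atTop :=
  Real.tendsto_log_atTop.comp tendsto_natCast_atTop_atTop

/-- The square of `√(2 ln k) - 6` falls short of `2 ln k` by `O(√(ln k))` only, which is eventually
less than `2 ln ln k √(ln k)`. -/
lemma eventually_le_expMax_sq : ∀ᶠ k : ℕ in atTop,
    2 * (1 + -(Real.log (Real.log k) / Real.log k ^ (1 / 2 : ℝ))) * Real.log k ≤ expMax k ^ 2 := by
  filter_upwards [tendsto_log_natCast.eventually_ge_atTop 18,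
    (Real.tendsto_log_atTop.comp tendsto_log_natCast).eventually_ge_atTop 9,
    eventually_gt_atTop 0] with k h18 h9 hk
  have : NeZero k := ⟨hk.ne'⟩
  simp only [Function.comp_apply] at h9
  set L := Real.log k with hL
  set l := Real.log L
  have hL0 : 0 < L := by linarith
  have hs : 0 < √L := Real.sqrt_pos.2 hL0
  have hsq : √L * √L = L := Real.mul_self_sqrt hL0.le
  have hT6 : 6 ≤ √(2 * L) := Real.le_sqrt_of_sq_le (by linarith)
  have h1 := sqrt_sub_le_expMax (k := k) (by rw [← hL]; linarith)
  rw [← hL] at h1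
  have hT : √(2 * L) ≤ 3 / 2 * √L := by
    rw [Real.sqrt_le_left (by positivity), mul_pow, Real.sq_sqrt hL0.le]
    linarith
  have hT2 : √(2 * L) ^ 2 = 2 * L := Real.sq_sqrt (by linarith)
  have h2 : (√(2 * L) - 6) ^ 2 ≤ expMax k ^ 2 := pow_le_pow_left₀ (by linarith) h1 2
  rw [← Real.sqrt_eq_rpow]
  have e : 2 * (1 + -(l / √L)) * L = 2 * L - 2 * l * √L := by
    have : L / √L = √L := by rw [div_eq_iff hs.ne', hsq]
    calc _ = 2 * L - 2 * l * (L / √L) := by ring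
      _ = _ := by rw [this]
  rw [e]
  have := mul_le_mul_of_nonneg_right h9 hs.le
  nlinarith

/-! ### Conflicts and feasibility -/

section

variable {V : Type*} [Fintype V] [DecidableEq V] {G : SimpleGraph V} [DecidableRel G.Adj]

lemma mem_inc {v : V} {e : G.edgeSet} : e ∈ inc G v ↔ v ∈ (e : Sym2 V) := by
  simp [inc]

/-- The number of conflicts as a sum over ordered pairs of edges at a node. -/
lemma conflicts_eq (c : G.edgeSet → ℕ) : (conflicts G c : ℝ) =
    ∑ v, ∑ e ∈ inc G v, ∑ e' ∈ inc G v, if c e = c e' then 1 else 0 := by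
  unfold conflicts confAt
  push_cast
  rw [Finset.sum_comm' (t' := Finset.univ) (s' := fun v => inc G v) (by simp [mem_inc])]
  refine Finset.sum_congr rfl fun v _ => Finset.sum_congr rfl fun e _ => ?_
  rw [Finset.card_filter]
  push_cast
  simp only [eq_comm]

lemma isFeasible_of_lt {C : V → ℕ} {k : ℕ} (hC : ∀ v, C v = 1 ∨ C v = k)
    {c : G.edgeSet → ℕ} (hlt : ∀ e, c e < k)
    (h1 : ∀ v, C v = 1 → ∀ e ∈ inc G v, ∀ e' ∈ inc G v, c e = c e') : IsFeasible G C k c := by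
  have hcard : ∀ s : Finset G.edgeSet, (s.image c).card ≤ k := fun s => by
    have : s.image c ⊆ Finset.range k := by
      intro j hj
      obtain ⟨e, -, rfl⟩ := Finset.mem_image.1 hj
      exact Finset.mem_range.2 (hlt e)
    simpa using Finset.card_le_card this
  refine ⟨fun v => ?_, hcard _⟩
  rcases hC v with h | h
  · rw [h, Finset.card_le_one]
    simp only [Finset.mem_image]
    rintro _ ⟨e, he, rfl⟩ _ ⟨e', he', rfl⟩
    exact h1 v h e he e' he'
  · rw [h]; exact hcard _

lemma exists_isFeasible_opt {C : V → ℕ} {k : ℕ} (hk : 1 ≤ k) (hC : ∀ v, C v = 1 ∨ C v = k) :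
    ∃ c : G.edgeSet → ℕ, IsFeasible G C k c ∧ conflicts G c = opt G C k :=
  Nat.sInf_mem (s := {n : ℕ | ∃ c : G.edgeSet → ℕ, IsFeasible G C k c ∧ conflicts G c = n})
    ⟨_, fun _ => 0, isFeasible_of_lt hC (fun _ => hk) fun _ _ _ _ _ _ => rfl, rfl⟩

lemma VPFeasible.eq_of_mem_inc {C : V → ℕ} {k m : ℕ}
    {Y : G.edgeSet → EuclideanSpace ℝ (Fin m)} (hY : VPFeasible G C k Y) {v : V} (hv : C v = 1)
    {e e' : G.edgeSet} (he : e ∈ inc G v) (he' : e' ∈ inc G v) : Y e = Y e' :=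
  (inner_eq_one_iff_of_norm_eq_one (hY.norm_eq e) (hY.norm_eq e')).1 (hY.inner_eq v hv e he e' he')

end

/-! ### The vector program as a relaxation -/

/-- The vertices of a regular simplex: `k` unit vectors with pairwise inner products
`-1 / (k - 1)`. -/
lemma exists_simplex {k : ℕ} (hk : 2 ≤ k) : ∃ w : Fin k → EuclideanSpace ℝ (Fin k),
    ∀ i j, inner ℝ (w i) (w j) = if i = j then 1 else -1 / ((k : ℝ) - 1) := by
  have h2 : (2 : ℝ) ≤ k := by exact_mod_cast hk
  have hk1 : (0 : ℝ) < k - 1 := by linarith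
  refine exists_gram_eq (M := fun i j => if i = j then 1 else -1 / ((k : ℝ) - 1))
    (posSemidef_of_quadratic (fun i j => by simp [eq_comm]) fun x => ?_)
  have e : ∑ i, ∑ j, x i * x j * (if i = j then (1 : ℝ) else -1 / ((k : ℝ) - 1)) =
      (k * ∑ i, x i ^ 2 - (∑ i, x i) ^ 2) / (k - 1) := by
    have : ∀ i j : Fin k, x i * x j * (if i = j then (1 : ℝ) else -1 / ((k : ℝ) - 1)) =
        (if i = j then x i * x j * (k / (k - 1)) else 0) - x i * x j * (1 / (k - 1)) := by
      intro i j
      split_ifs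
      · field_simp
      · ring
    simp only [this, Finset.sum_sub_distrib, Finset.sum_ite_eq, Finset.mem_univ, if_true]
    rw [sq (∑ i, x i), Finset.sum_mul_sum]
    simp only [← Finset.sum_mul]
    rw [sub_div, mul_comm (k : ℝ), Finset.sum_congr rfl fun i _ => (sq (x i)).symm]
    ring
  rw [e]
  have := sq_sum_le_card_mul_sum_sq (s := Finset.univ) (f := x)
  rw [Finset.card_univ, Fintype.card_fin] at this
  exact div_nonneg (by linarith) hk1.le

section

variable {V : Type*} [Fintype V] [DecidableEq V] {G : SimpleGraph V} [DecidableRel G.Adj]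

/-- Replacing channels by simplex vertices turns a feasible assignment into a feasible solution of
the vector program whose value is the number of conflicts. -/
lemma exists_vpFeasible_of_isFeasible {C : V → ℕ} {k : ℕ} (hk : 2 ≤ k) {c : G.edgeSet → ℕ}
    (hc : IsFeasible G C k c) : ∃ Y : G.edgeSet → EuclideanSpace ℝ (Fin k),
      VPFeasible G C k Y ∧ vpValue G k Y = conflicts G c := by
  obtain ⟨w, hw⟩ := exists_simplex hk
  have h2 : (2 : ℝ) ≤ k := by exact_mod_cast hk
  have hk1 : (0 : ℝ) < k - 1 := by linarith
  obtain ⟨f⟩ : Nonempty (Finset.univ.image c ↪ Fin k) := by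
    refine Function.Embedding.nonempty_of_card_le ?_
    simpa using hc.2
  let F : G.edgeSet → Fin k := fun e => f ⟨c e, Finset.mem_image_of_mem c (Finset.mem_univ e)⟩
  have hF : ∀ e e', F e = F e' ↔ c e = c e' := fun e e' => by simp [F]
  have hin : ∀ e e', inner ℝ (w (F e)) (w (F e')) = if c e = c e' then 1 else -1 / ((k : ℝ) - 1) :=
    fun e e' => by simp only [hw, hF]
  refine ⟨fun e => w (F e), ⟨fun e => ?_, fun v hv e he e' he' => ?_, fun v e _ e' _ => ?_⟩, ?_⟩
  · rw [← sq_eq_sq₀ (norm_nonneg _) zero_le_one, ← real_inner_self_eq_norm_sq, hin, if_pos rfl,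
      one_pow]
  · have h := hc.1 v
    rw [hv, Finset.card_le_one] at h
    rw [hin, if_pos (h _ (Finset.mem_image_of_mem c he) _ (Finset.mem_image_of_mem c he'))]
  · rw [hin]
    split_ifs
    · rw [div_le_one hk1]; linarith
    · exact le_rfl
  · rw [conflicts_eq, vpValue]
    refine Finset.sum_congr rfl fun v _ => Finset.sum_congr rfl fun e _ =>
      Finset.sum_congr rfl fun e' _ => ?_
    rw [hin]
    split_ifs
    · field_simp; ring
    · field_simp; ring

/-- The vector program is a relaxation: its solutions have value at most `OPT + δ`. -/
lemma IsVPSolution.vpValue_le {C : V → ℕ} {k m : ℕ} (hk : 2 ≤ k) (hC : ∀ v, C v = 1 ∨ C v = k)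
    {δ : ℝ} {Y : G.edgeSet → EuclideanSpace ℝ (Fin m)} (hY : IsVPSolution G C k δ Y) :
    vpValue G k Y ≤ opt G C k + δ := by
  obtain ⟨c, hc, hopt⟩ := exists_isFeasible_opt (G := G) (by omega : 1 ≤ k) hC
  obtain ⟨Y', hY', hval⟩ := exists_vpFeasible_of_isFeasible hk hc
  rw [← hopt, ← hval]
  exact hY.2 _ Y' hY'

/-- Feasibility and value depend on the Gram matrix only. -/
lemma VPFeasible.exists_card_dim {C : V → ℕ} {k m : ℕ} {Y : G.edgeSet → EuclideanSpace ℝ (Fin m)}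
    (hY : VPFeasible G C k Y) :
    ∃ Y' : G.edgeSet → EuclideanSpace ℝ (Fin (Fintype.card G.edgeSet)),
      VPFeasible G C k Y' ∧ vpValue G k Y' = vpValue G k Y := by
  obtain ⟨Y', h⟩ := exists_inner_eq Y
  refine ⟨Y', ⟨fun e => ?_, fun v hv e he e' he' => ?_, fun v e he e' he' => ?_⟩, ?_⟩
  · rw [← sq_eq_sq₀ (norm_nonneg _) zero_le_one, ← real_inner_self_eq_norm_sq, h,
      real_inner_self_eq_norm_sq, hY.norm_eq]
  · rw [h]; exact hY.inner_eq v hv e he e' he'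
  · rw [h]; exact hY.inner_ge v e he e' he'
  · simp only [vpValue, h]

/-- The feasible solutions in dimension `|E|` form a nonempty compact set. -/
lemma exists_isVPSolution_zero {C : V → ℕ} {k : ℕ} (hk : 2 ≤ k) (hC : ∀ v, C v = 1 ∨ C v = k) :
    ∃ Y : G.edgeSet → EuclideanSpace ℝ (Fin (Fintype.card G.edgeSet)), IsVPSolution G C k 0 Y := by
  let S : Set (G.edgeSet → EuclideanSpace ℝ (Fin (Fintype.card G.edgeSet))) :=
    {Y | VPFeasible G C k Y}
  have hne : S.Nonempty := by
    obtain ⟨c, hc, -⟩ := exists_isFeasible_opt (G := G) (by omega : 1 ≤ k) hC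
    obtain ⟨Y, hY, -⟩ := exists_vpFeasible_of_isFeasible hk hc
    obtain ⟨Y', hY', -⟩ := hY.exists_card_dim
    exact ⟨Y', hY'⟩
  have hcl : IsClosed S := by
    have : S = {Y | ∀ e, ‖Y e‖ = 1} ∩
        {Y | ∀ v, C v = 1 → ∀ e ∈ inc G v, ∀ e' ∈ inc G v, inner ℝ (Y e) (Y e') = (1 : ℝ)} ∩
        {Y | ∀ v, ∀ e ∈ inc G v, ∀ e' ∈ inc G v,
          -1 / ((k : ℝ) - 1) ≤ inner ℝ (Y e) (Y e')} := by
      ext Y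
      exact ⟨fun h => ⟨⟨h.1, h.2⟩, h.3⟩, fun h => ⟨h.1.1, h.1.2, h.2⟩⟩
    rw [this]
    simp only [Set.ofPred_forall]
    refine (IsClosed.inter ?_ ?_).inter ?_
    · exact isClosed_iInter fun e => isClosed_eq (by fun_prop) (by fun_prop)
    · exact isClosed_iInter fun v => isClosed_iInter fun _ => isClosed_iInter fun e =>
        isClosed_iInter fun _ => isClosed_iInter fun e' => isClosed_iInter fun _ =>
          isClosed_eq (by fun_prop) (by fun_prop)
    · exact isClosed_iInter fun v => isClosed_iInter fun e => isClosed_iInter fun _ =>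
        isClosed_iInter fun e' => isClosed_iInter fun _ => isClosed_le (by fun_prop) (by fun_prop)
  have hbd : S ⊆ Metric.closedBall 0 1 := fun Y hY => by
    rw [mem_closedBall_zero_iff, pi_norm_le_iff_of_nonneg zero_le_one]
    exact fun e => (hY.norm_eq e).le
  have hcomp : IsCompact S := (isCompact_closedBall _ _).of_isClosed_subset hcl hbd
  obtain ⟨Y, hY, hmin⟩ := hcomp.exists_isMinOn hne
    (f := fun Y => vpValue G k Y) (by unfold vpValue; fun_prop)
  refine ⟨Y, hY, fun m' Y' hY' => ?_⟩
  obtain ⟨Y'', hY'', hval⟩ := hY'.exists_card_dim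
  rw [add_zero, ← hval]
  exact hmin hY''

end

/-! ### Expected conflicts after rounding -/

section

variable {V : Type*} {G : SimpleGraph V}

lemma measurable_gwRound {m : ℕ} (Y : G.edgeSet → EuclideanSpace ℝ (Fin m)) (e : G.edgeSet) :
    Measurable fun r => gwRound Y r e :=
  Measurable.ite (measurableSet_le measurable_const (by fun_prop)) measurable_const measurable_const

lemma gwRound_eq_iff {m : ℕ} (Y : G.edgeSet → EuclideanSpace ℝ (Fin m))
    (r : EuclideanSpace ℝ (Fin m)) (e e' : G.edgeSet) : gwRound Y r e = gwRound Y r e' ↔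
      (0 ≤ (inner ℝ r (Y e) : ℝ) ↔ 0 ≤ (inner ℝ r (Y e') : ℝ)) := by
  unfold gwRound
  split_ifs <;> simp [*]

lemma fjRound_eq {k m : ℕ} (Y : G.edgeSet → EuclideanSpace ℝ (Fin m))
    (g : Fin k → EuclideanSpace ℝ (Fin m)) (e : G.edgeSet) :
    fjRound Y g e = argmax fun i => inner ℝ (g i) (Y e) := rfl

lemma measurable_fjRound {k m : ℕ} [NeZero k] (Y : G.edgeSet → EuclideanSpace ℝ (Fin m))
    (e : G.edgeSet) : Measurable fun g : Fin k → EuclideanSpace ℝ (Fin m) => fjRound Y g e :=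
  measurable_argmax.comp (by fun_prop)

/-- The affine majorant of the probability of equal channels under hyperplane rounding. -/
lemma gwRound_same_le {m : ℕ} {Y : G.edgeSet → EuclideanSpace ℝ (Fin m)} (hY : ∀ e, ‖Y e‖ = 1)
    (e e' : G.edgeSet) :
    (stdGaussian (EuclideanSpace ℝ (Fin m))).real {r | gwRound Y r e = gwRound Y r e'} ≤
      0.561 + 0.439 * inner ℝ (Y e) (Y e') := by
  set ρ : ℝ := inner ℝ (Y e) (Y e') with hρ
  have h := abs_real_inner_le_norm (Y e) (Y e')
  rw [hY, hY, one_mul, abs_le] at h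
  have h1 : {r | gwRound Y r e = gwRound Y r e'} =
      {r | ¬ (0 ≤ (inner ℝ r (Y e) : ℝ) ↔ 0 ≤ (inner ℝ r (Y e') : ℝ))}ᶜ := by
    ext r
    simp only [Set.mem_ofPred_eq, gwRound_eq_iff, Set.mem_compl_iff, not_not]
  rw [h1, probReal_compl_eq_one_sub (measurableSet_sep (by fun_prop) (by fun_prop)),
    stdGaussian_real_sep (hY e) (hY e'), ← hρ]
  have h2 := goemansWilliamson_le (Real.arccos_nonneg ρ) (Real.arccos_le_pi ρ)
  have h3 := div_pi_le_sepProb_cos (Real.arccos_nonneg ρ) (Real.arccos_le_pi ρ)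
  rw [Real.cos_arccos h.1 h.2] at h2 h3
  linarith

lemma fjRound_same {k m : ℕ} [NeZero k] {Y : G.edgeSet → EuclideanSpace ℝ (Fin m)}
    (hY : ∀ e, ‖Y e‖ = 1) (e e' : G.edgeSet) :
    (Measure.pi fun _ : Fin k => stdGaussian (EuclideanSpace ℝ (Fin m))).real
      {g | fjRound Y g e = fjRound Y g e'} = sameProb k (inner ℝ (Y e) (Y e')) := by
  rw [sameProb, ← map_inner_inner_pi k (hY e) (hY e'), integral_map (by fun_prop)
    measurable_same.aestronglyMeasurable]
  have hm : MeasurableSet {g : Fin k → EuclideanSpace ℝ (Fin m) | fjRound Y g e = fjRound Y g e'} :=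
    measurableSet_eq_fun (measurable_fjRound Y e) (measurable_fjRound Y e')
  rw [← integral_indicator_one hm]
  refine integral_congr_ae (Filter.Eventually.of_forall fun g => ?_)
  simp [Set.indicator_apply, fjRound_eq]

end

section

variable {V : Type*} [Fintype V] [DecidableEq V] {G : SimpleGraph V} [DecidableRel G.Adj]

lemma integrable_conflicts {Ω : Type*} [MeasurableSpace Ω] {P : Measure Ω} [IsProbabilityMeasure P]
    {c : Ω → G.edgeSet → ℕ} (hc : ∀ e, Measurable fun ω => c ω e) :
    Integrable (fun ω => (conflicts G (c ω) : ℝ)) P ∧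
      ∫ ω, (conflicts G (c ω) : ℝ) ∂P =
        ∑ v, ∑ e ∈ inc G v, ∑ e' ∈ inc G v, P.real {ω | c ω e = c ω e'} := by
  have hm : ∀ e e', MeasurableSet {ω | c ω e = c ω e'} := fun e e' =>
    measurableSet_eq_fun (hc e) (hc e')
  have hite : ∀ e e', (fun ω => if c ω e = c ω e' then (1 : ℝ) else 0) =
      {ω | c ω e = c ω e'}.indicator fun _ => 1 := fun e e' => by
    ext ω; simp [Set.indicator_apply]
  have hi : ∀ e e', Integrable (fun ω => if c ω e = c ω e' then (1 : ℝ) else 0) P := fun e e' => by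
    rw [hite]; exact (integrable_const 1).indicator (hm e e')
  have hi2 : ∀ v e, Integrable
      (fun ω => ∑ e' ∈ inc G v, if c ω e = c ω e' then (1 : ℝ) else 0) P := fun v e =>
    integrable_finsetSum _ fun e' _ => hi e e'
  have hi3 : ∀ v, Integrable
      (fun ω => ∑ e ∈ inc G v, ∑ e' ∈ inc G v, if c ω e = c ω e' then (1 : ℝ) else 0) P := fun v =>
    integrable_finsetSum _ fun e _ => hi2 v e
  simp only [conflicts_eq]
  refine ⟨integrable_finsetSum _ fun v _ => hi3 v, ?_⟩
  rw [integral_finsetSum _ fun v _ => hi3 v]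
  refine Finset.sum_congr rfl fun v _ => ?_
  rw [integral_finsetSum _ fun e _ => hi2 v e]
  refine Finset.sum_congr rfl fun e _ => ?_
  rw [integral_finsetSum _ fun e' _ => hi e e']
  refine Finset.sum_congr rfl fun e' _ => ?_
  rw [hite, integral_indicator (hm e e')]
  simp

/-- If the probability of equal channels is at most `Γ / k + b ρ` in terms of the inner product `ρ`,
then the expected number of conflicts is at most `Γ` times the value of the vector program. Only the
total over all pairs of edges at a node is compared: it involves `∑ ρ = |∑ Y_e|² ≥ 0`, which allows
the coefficient `b` to be increased to `Γ (k - 1) / k`. -/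
lemma sum_le_mul_vpValue {k m : ℕ} (hk : 0 < k) {Y : G.edgeSet → EuclideanSpace ℝ (Fin m)}
    {f : G.edgeSet → G.edgeSet → ℝ} {Γ b : ℝ} (hb : b ≤ Γ * ((k - 1) / k))
    (hf : ∀ v, ∀ e ∈ inc G v, ∀ e' ∈ inc G v, f e e' ≤ Γ / k + b * inner ℝ (Y e) (Y e')) :
    ∑ v, ∑ e ∈ inc G v, ∑ e' ∈ inc G v, f e e' ≤ Γ * vpValue G k Y := by
  have hk0 : (0 : ℝ) < k := by exact_mod_cast hk
  rw [vpValue, Finset.mul_sum]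
  refine Finset.sum_le_sum fun v _ => ?_
  have hS : ∑ e ∈ inc G v, ∑ e' ∈ inc G v, (inner ℝ (Y e) (Y e') : ℝ) =
      ‖∑ e ∈ inc G v, Y e‖ ^ 2 := by
    rw [← real_inner_self_eq_norm_sq, sum_inner]
    simp only [inner_sum]
  have hS0 : 0 ≤ ∑ e ∈ inc G v, ∑ e' ∈ inc G v, (inner ℝ (Y e) (Y e') : ℝ) := by
    rw [hS]; positivity
  calc ∑ e ∈ inc G v, ∑ e' ∈ inc G v, f e e'
      ≤ ∑ e ∈ inc G v, ∑ e' ∈ inc G v, (Γ / k + b * inner ℝ (Y e) (Y e')) :=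
        Finset.sum_le_sum fun e he => Finset.sum_le_sum fun e' he' => hf v e he e' he'
    _ = ∑ _e ∈ inc G v, ∑ _e' ∈ inc G v, Γ / k
          + b * ∑ e ∈ inc G v, ∑ e' ∈ inc G v, (inner ℝ (Y e) (Y e') : ℝ) := by
        simp only [Finset.sum_add_distrib, Finset.mul_sum]
    _ ≤ ∑ _e ∈ inc G v, ∑ _e' ∈ inc G v, Γ / k + Γ * ((k - 1) / k) *
          ∑ e ∈ inc G v, ∑ e' ∈ inc G v, (inner ℝ (Y e) (Y e') : ℝ) := by
        have := mul_le_mul_of_nonneg_right hb hS0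
        linarith
    _ = Γ * ∑ e ∈ inc G v, ∑ e' ∈ inc G v,
          1 / (k : ℝ) * (((k : ℝ) - 1) * inner ℝ (Y e) (Y e') + 1) := by
        simp only [Finset.mul_sum, ← Finset.sum_add_distrib]
        refine Finset.sum_congr rfl fun e _ => Finset.sum_congr rfl fun e' _ => ?_
        field_simp
        ring

lemma isFeasible_gwRound {C : V → ℕ} {m : ℕ} (hC : ∀ v, C v = 1 ∨ C v = 2)
    {Y : G.edgeSet → EuclideanSpace ℝ (Fin m)} (hY : VPFeasible G C 2 Y)
    (r : EuclideanSpace ℝ (Fin m)) : IsFeasible G C 2 (gwRound Y r) := by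
  refine isFeasible_of_lt hC (fun e => ?_) fun v hv e he e' he' => ?_
  · unfold gwRound; split_ifs <;> norm_num
  · simp only [gwRound, hY.eq_of_mem_inc hv he he']

lemma isFeasible_fjRound {C : V → ℕ} {k m : ℕ} (hk : 2 ≤ k) (hC : ∀ v, C v = 1 ∨ C v = k)
    {Y : G.edgeSet → EuclideanSpace ℝ (Fin m)} (hY : VPFeasible G C k Y)
    (g : Fin k → EuclideanSpace ℝ (Fin m)) : IsFeasible G C k (fjRound Y g) := by
  have : NeZero k := ⟨by omega⟩
  refine isFeasible_of_lt hC (fun e => (argmax_spec _).1) fun v hv e he e' he' => ?_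
  simp only [fjRound, hY.eq_of_mem_inc hv he he']

/-- The expected number of conflicts after Goemans-Williamson rounding. -/
lemma integral_conflicts_gwRound_le {C : V → ℕ} {m : ℕ}
    {Y : G.edgeSet → EuclideanSpace ℝ (Fin m)} (hY : VPFeasible G C 2 Y) :
    ∫ r, (conflicts G (gwRound Y r) : ℝ) ∂(stdGaussian (EuclideanSpace ℝ (Fin m))) ≤
      1.122 * vpValue G 2 Y := by
  rw [(integrable_conflicts (measurable_gwRound Y)).2]
  refine sum_le_mul_vpValue (b := 0.439) two_pos (by norm_num) fun v e _ e' _ => ?_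
  refine (gwRound_same_le hY.norm_eq e e').trans_eq ?_
  norm_num

/-- The expected number of conflicts after Frieze-Jerrum rounding. -/
lemma integral_conflicts_fjRound_le {C : V → ℕ} {k m : ℕ} (hk : 2 ≤ k)
    {Y : G.edgeSet → EuclideanSpace ℝ (Fin m)} (hY : VPFeasible G C k Y) :
    ∫ g : Fin k → EuclideanSpace ℝ (Fin m), (conflicts G (fjRound Y g) : ℝ)
      ∂(Measure.pi fun _ => stdGaussian (EuclideanSpace ℝ (Fin m))) ≤
      fjFactor k * vpValue G k Y := by
  have : NeZero k := ⟨by omega⟩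
  have hk0 : (0 : ℝ) < k := by exact_mod_cast (by omega : 0 < k)
  rw [(integrable_conflicts (measurable_fjRound Y)).2]
  refine sum_le_mul_vpValue (b := 1 - fjFactor k / k) (by omega) ?_ fun v e he e' he' => ?_
  · have := one_le_fjFactor hk
    have e : fjFactor k * (((k : ℝ) - 1) / k) = fjFactor k - fjFactor k / k := by
      field_simp
    linarith
  · rw [fjRound_same hY.norm_eq]
    have h1 := real_inner_le_norm (Y e) (Y e')
    rw [hY.norm_eq, hY.norm_eq, one_mul] at h1
    exact sameProb_le hk (hY.inner_ge v e he e' he') h1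

end

end SoftColoring

end

open SoftColoring MeasureTheory ProbabilityTheory Filter Asymptotics in
theorem mainTheorem9 :
    -- the vector program has an optimal solution, and it is a relaxation
    (∀ (V : Type*) [Fintype V] [DecidableEq V] (G : SimpleGraph V) [DecidableRel G.Adj]
        (k : ℕ) (C : V → ℕ), 2 ≤ k → (∀ v, C v = 1 ∨ C v = k) →
      (∃ m ≤ Fintype.card G.edgeSet, ∃ Y : G.edgeSet → EuclideanSpace ℝ (Fin m),
        IsVPSolution G C k 0 Y) ∧
      ∀ (m : ℕ) (δ : ℝ) (Y : G.edgeSet → EuclideanSpace ℝ (Fin m)),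
        IsVPSolution G C k δ Y → vpValue G k Y ≤ opt G C k + δ) ∧
    -- two channels, Goemans-Williamson rounding
    (∀ (V : Type*) [Fintype V] [DecidableEq V] (G : SimpleGraph V) [DecidableRel G.Adj]
        (C : V → ℕ), (∀ v, C v = 1 ∨ C v = 2) →
      ∀ (m : ℕ) (δ : ℝ) (Y : G.edgeSet → EuclideanSpace ℝ (Fin m)), IsVPSolution G C 2 δ Y →
        (∀ r, IsFeasible G C 2 (gwRound Y r)) ∧
        Integrable (fun r => (conflicts G (gwRound Y r) : ℝ))
          (stdGaussian (EuclideanSpace ℝ (Fin m))) ∧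
        ∫ r, (conflicts G (gwRound Y r) : ℝ) ∂(stdGaussian (EuclideanSpace ℝ (Fin m)))
          ≤ 1.122 * (opt G C 2 + δ)) ∧
    -- `k` channels, Frieze-Jerrum rounding
    (∃ ε η : ℕ → ℝ,
      (fun k => |ε k|) ~[atTop] (fun k : ℕ => Real.log (Real.log k) / Real.log k ^ (1 / 2 : ℝ)) ∧
      η =O[atTop] (fun k : ℕ => (k : ℝ) / ((k : ℝ) - 1) ^ 2) ∧
      ∀ (V : Type*) [Fintype V] [DecidableEq V] (G : SimpleGraph V) [DecidableRel G.Adj]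
        (k : ℕ) (C : V → ℕ), 2 ≤ k → (∀ v, C v = 1 ∨ C v = k) →
      ∀ (m : ℕ) (δ : ℝ) (Y : G.edgeSet → EuclideanSpace ℝ (Fin m)), IsVPSolution G C k δ Y →
        (∀ g : Fin k → EuclideanSpace ℝ (Fin m), IsFeasible G C k (fjRound Y g)) ∧
        Integrable (fun g : Fin k → EuclideanSpace ℝ (Fin m) => (conflicts G (fjRound Y g) : ℝ))
          (Measure.pi fun _ => stdGaussian (EuclideanSpace ℝ (Fin m))) ∧
        ∫ g : Fin k → EuclideanSpace ℝ (Fin m), (conflicts G (fjRound Y g) : ℝ)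
            ∂(Measure.pi fun _ => stdGaussian (EuclideanSpace ℝ (Fin m)))
          ≤ (2 - 1 / (k : ℝ) - 2 * (1 + ε k) * Real.log k / k + η k) * (opt G C k + δ)) := by
  refine ⟨?_, ?_, ?_⟩
  · intro V _ _ G _ k C hk hC
    refine ⟨⟨_, le_rfl, exists_isVPSolution_zero hk hC⟩, fun m δ Y hY => hY.vpValue_le hk hC⟩
  · intro V _ _ G _ C hC m δ Y hY
    refine ⟨isFeasible_gwRound hC hY.1, (integrable_conflicts (measurable_gwRound Y)).1, ?_⟩
    refine (integral_conflicts_gwRound_le hY.1).trans ?_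
    exact mul_le_mul_of_nonneg_left (hY.vpValue_le le_rfl hC) (by norm_num)
  · let ε : ℕ → ℝ := fun k => -(Real.log (Real.log k) / Real.log k ^ (1 / 2 : ℝ))
    -- `η` is the defect of the main terms; it is cut off at `0` because only an upper bound of it
    -- is available
    let η : ℕ → ℝ := fun k =>
      max 0 (2 * (1 + ε k) * Real.log k / k - expMax k ^ 2 / k + 2 / ((k : ℝ) - 1))
    refine ⟨ε, η, ?_, ?_, ?_⟩
    · refine EventuallyEq.isEquivalent ?_
      filter_upwards [tendsto_log_natCast.eventually_ge_atTop 1] with k hk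
      simp only [ε, abs_neg]
      exact abs_of_nonneg (div_nonneg (Real.log_nonneg hk) (by positivity))
    · refine IsBigO.of_bound 2 ?_
      filter_upwards [eventually_le_expMax_sq, eventually_ge_atTop 2] with k hμ hk
      have h2 : (2 : ℝ) ≤ k := by exact_mod_cast hk
      have hk1 : (0 : ℝ) < k - 1 := by linarith
      have h3 : 2 * (1 + ε k) * Real.log k / k ≤ expMax k ^ 2 / k :=
        div_le_div_of_nonneg_right hμ (by linarith)
      have h4 : 2 / ((k : ℝ) - 1) ≤ 2 * (k / ((k : ℝ) - 1) ^ 2) := by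
        rw [div_le_iff₀ hk1]
        have : 2 * (k / ((k : ℝ) - 1) ^ 2) * (k - 1) = 2 * (k / (k - 1)) := by field_simp
        rw [this]
        have : 1 ≤ (k : ℝ) / (k - 1) := by rw [one_le_div hk1]; linarith
        linarith
      have h5 : 0 ≤ (k : ℝ) / ((k : ℝ) - 1) ^ 2 := by positivity
      rw [Real.norm_of_nonneg (le_max_left _ _), Real.norm_of_nonneg h5]
      exact max_le (by positivity) (by linarith)
    · intro V _ _ G _ k C hk hC m δ Y hY
      have : NeZero k := ⟨by omega⟩
      refine ⟨isFeasible_fjRound hk hC hY.1, (integrable_conflicts (measurable_fjRound Y)).1, ?_⟩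
      have h1 := one_le_fjFactor hk
      have h2 : fjFactor k ≤ 2 - 1 / (k : ℝ) - 2 * (1 + ε k) * Real.log k / k + η k := by
        have := le_max_right 0
          (2 * (1 + ε k) * Real.log k / k - expMax k ^ 2 / k + 2 / ((k : ℝ) - 1))
        simp only [fjFactor, η]
        linarith
      have hδ : 0 ≤ δ := by linarith [hY.2 m Y hY.1]
      calc _ ≤ fjFactor k * vpValue G k Y := integral_conflicts_fjRound_le hk hY.1
        _ ≤ fjFactor k * (opt G C k + δ) :=
          mul_le_mul_of_nonneg_left (hY.vpValue_le hk hC) (by linarith)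
        _ ≤ _ := mul_le_mul_of_nonneg_right h2 (by positivity)
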